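/- **Setting.** Let $r\ge 1$, let $(a_0,\dots,a_r)\in\mathbb R^{r+1}$ be nonzero, and let $w=(w^0,\dots,w^{r-1})$ be coordinates on $\mathbb R^r$. Put $w^r=1$, and $w^n=a_n=0$ for $n<0$ or $n>r$. Let $$\mathcal D_n=2w^n\partial_x+w^n_x-\tfrac{\epsilon^2}{2}a_n\partial_x^3,\qquad (P_m)^{ij}=f_m^{ij}\,\mathcal D_{i+j+1-m}\quad(0\le i,j\le r-1,\ 0\le m\le r),$$ where $f_m^{ij}=1$ if $i,j<m$, $f_m^{ij}=-1$ if $i,j\ge m$, and $f_m^{ij}=0$ otherwise. For $k\neq l$ in $\{0,\dots,r\}$ let $B_{k,l}=(P_k,P_l)$ be the associated bihamiltonian structure of the $r$-KdV-CH hierarchy. The leading term of $P_m$ is its part at $\epsilon=0$; its metric is $g_m^{ij}=2f_m^{ij}w^{i+j+1-m}$. Let $U\subset\mathbb R^r$ be any nonempty open set on which the complex roots of $\lambda^r+w^{r-1}\lambda^{r-1}+\cdots+w^0$ are pairwise distinct and $g_k,g_l$ are nondegenerate. A Frobenius manifold is described in flat coordinates $v^1,\dots,v^r$ by a smooth potential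 $F(v)$ satisfying: $\partial_1\partial_\alpha\partial_\beta F=\eta_{\alpha\beta}$ is constant with $\det\eta\ne0$; with $(\eta^{\alpha\beta})=(\eta_{\alpha\beta})^{-1}$, $$\partial_\alpha\partial_\beta\partial_\xi F\,\eta^{\xi\sigma}\,\partial_\sigma\partial_\nu\partial_\mu F=\partial_\mu\partial_\beta\partial_\xi F\,\eta^{\xi\sigma}\,\partial_\sigma\partial_\nu\partial_\alpha F\quad\text{for all }\alpha,\beta,\nu,\mu;$$ and, for the Euler vector field $E=\sum_\alpha(d_\alpha v^\alpha+r_\alpha)\partial_\alpha$ with constants $d_\alpha,r_\alpha$ and a constant $d$, $\partial_EF=(3-d)F+(\text{a polynomial of degree}\le 2\text{ in }v)$. Its bihamiltonian structure is $$P_{fm}^{\alpha\beta}=\eta^{\alpha\beta}\partial_x,\qquad Q_{fm}^{\alpha\beta}=g^{\alpha\beta}\partial_x+\Gamma^{\alpha\beta}_\gamma v^\gamma_x,\qquad g^{\alpha\beta}=\sum_{\sigma,\gamma,\nu}(d_\sigma v^\sigma+r_\sigma)\eta^{\alpha\gamma}\eta^{\beta\nu}\partial_\sigma\partial_\gamma\partial_\nu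 F,$$ with $\Gamma^{\alpha\beta}_\gamma=-g^{\alpha\nu}\Gamma^\beta_{\nu\gamma}$ given by the Christoffel symbols $\Gamma^\beta_{\nu\gamma}$ of the Levi-Civita connection of $(g^{\alpha\beta})^{-1}$. The leading term of $B_{k,l}$ is *given on $U$* by the Frobenius manifold if there is a smooth change of coordinates $v=v(w)$ on $U$ (with $F$ defined on $v(U)$) carrying the leading terms of $P_k$ and $P_l$ to $P_{fm}$ and $Q_{fm}$ respectively. **Theorem.** The leading term of $B_{k,l}$ is given on $U$ by the bihamiltonian structure $(P_{fm},Q_{fm})$ of a Frobenius manifold if and only if $(k,l)=(0,1)$ and $r\in\{1,2\}$. The same equivalence holds if the Euler vector field is moreover required to be normalized by $d_1=1$. Explicitly, the leading term of $B_{0,1}$ is given on $U$: * for $r=1$, by the Frobenius manifold with potential $F=-\dfrac{(v^1)^3}{12}$, $v^1=w^0$, with $E=-v^1\partial_1$ and $d=6$; * for $r=2$, by the Frobenius manifold with potential $F=-\dfrac{(v^1)^2v^2}{4}+\dfrac14(v^2)^2\log|v^2|$, $v^1=w^1$, $v^2=w^0-\tfrac14(w^1)^2$, with $E=-\tfrac12v^1\partial_1-v^2\partial_2$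 and $d=5$. -/

import Mathlib

open scoped ContDiff

namespace RKdVCH

/-- A matrix differential operator on the loop space, given by its action: it takes a loop
`x ↦ w(x)` and a covector function `x ↦ ξ(x)` along the loop and returns `x ↦ (P ξ)(x)`. -/
abbrev LoopOp (r : ℕ) : Type :=
  (ℝ → Fin r → ℝ) → (ℝ → Fin r → ℝ) → ℝ → Fin r → ℝ

/-! ### The Hamiltonian structures of the `r`-KdV-CH hierarchy -/

/-- `w^n` for every integer `n`: the coordinates for `0 ≤ n < r`, `w^r = 1`, and `0` otherwise. -/
noncomputable def wExt {r : ℕ} (w : Fin r → ℝ) (n : ℤ) : ℝ :=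
  if h : 0 ≤ n ∧ n < r then w ⟨n.toNat, by omega⟩ else if n = r then 1 else 0

/-- `a_n` for every integer `n`: the parameters for `0 ≤ n ≤ r`, and `0` otherwise. -/
noncomputable def aExt {r : ℕ} (a : Fin (r + 1) → ℝ) (n : ℤ) : ℝ :=
  if h : 0 ≤ n ∧ n ≤ r then a ⟨n.toNat, by omega⟩ else 0

/-- `𝒟_n = 2 w^n ∂ₓ + w^n_x - (ε² / 2) a_n ∂ₓ³`. -/
noncomputable def opD {r : ℕ} (a : Fin (r + 1) → ℝ) (ε : ℝ) (w : ℝ → Fin r → ℝ) (n : ℤ)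
    (φ : ℝ → ℝ) (x : ℝ) : ℝ :=
  2 * wExt (w x) n * deriv φ x + deriv (fun y => wExt (w y) n) x * φ x
    - ε ^ 2 / 2 * aExt a n * iteratedDeriv 3 φ x

/-- The constants `f_m^{ij}`. -/
def coeffF (m i j : ℕ) : ℝ :=
  if i < m ∧ j < m then 1 else if m ≤ i ∧ m ≤ j then -1 else 0

/-- The Hamiltonian structure `P_m`, with components
`(P_m)^{ij} = f_m^{ij} 𝒟_{i + j + 1 - m}`, as a family of operators depending on `ε`. -/
noncomputable def hamP {r : ℕ} (a : Fin (r + 1) → ℝ) (m : ℕ) (ε : ℝ) : LoopOp r :=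
  fun w ξ x i => ∑ j : Fin r,
    coeffF m i j * opD a ε w ((i : ℤ) + j + 1 - m) (fun y => ξ y j) x

/-- The leading term of an operator depending polynomially on `ε`: its coefficient of `ε⁰`. -/
def leadingTerm {r : ℕ} (P : ℝ → LoopOp r) : LoopOp r := P 0

/-- The contravariant metric `g_m` of the leading term of `P_m`, i.e. the coefficient matrix of
`∂ₓ` in that leading term. -/
noncomputable def metricP (r m : ℕ) (w : Fin r → ℝ) : Matrix (Fin r) (Fin r) ℝ :=
  Matrix.of fun i j => 2 * coeffF m i j * wExt w ((i : ℤ) + j + 1 - m)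

/-- The polynomial `λ^r + w^{r-1} λ^{r-1} + ⋯ + w^1 λ + w^0`, over `ℂ`. -/
noncomputable def polyW {r : ℕ} (w : Fin r → ℝ) : Polynomial ℂ :=
  Polynomial.X ^ r + ∑ i : Fin r, Polynomial.C ((w i : ℝ) : ℂ) * Polynomial.X ^ (i : ℕ)

/-- The domains on which the leading term of `(P_k, P_l)` is considered: nonempty open sets on
which the roots of `polyW w` are pairwise distinct and both leading metrics are nondegenerate. -/
structure IsAdmissible {r : ℕ} (k l : ℕ) (U : Set (Fin r → ℝ)) : Prop where
  isOpen : IsOpen U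
  nonempty : U.Nonempty
  roots_distinct : ∀ w ∈ U, (polyW w).roots.Nodup
  det_left : ∀ w ∈ U, (metricP r k w).det ≠ 0
  det_right : ∀ w ∈ U, (metricP r l w).det ≠ 0

/-! ### Frobenius manifolds in flat coordinates -/

/-- The partial derivative `∂f/∂v^α`. -/
noncomputable def pd {r : ℕ} (α : Fin r) (f : (Fin r → ℝ) → ℝ) (v : Fin r → ℝ) : ℝ :=
  fderiv ℝ f v (Pi.single α 1)

/-- The third partial derivatives `∂³F/∂v^α∂v^β∂v^γ`. -/
noncomputable def pd3 {r : ℕ} (F : (Fin r → ℝ) → ℝ) (α β γ : Fin r) (v : Fin r → ℝ) : ℝ :=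
  pd α (pd β (pd γ F)) v

/-- `F` is, on the set `V` of values of the flat coordinates `v^1, …, v^r` (indexed by `Fin r`, so
that `v^1` is `v 0`), the potential of a Frobenius manifold with unit vector field `∂/∂v^1`, flat
metric `η`, Euler vector field `E = ∑ (q_α v^α + ρ_α) ∂/∂v^α` and charge `d`. -/
structure IsFrobenius {r : ℕ} [NeZero r] (V : Set (Fin r → ℝ)) (F : (Fin r → ℝ) → ℝ)
    (η : Matrix (Fin r) (Fin r) ℝ) (q ρ : Fin r → ℝ) (d : ℝ) : Prop where
  isOpen : IsOpen V
  smooth : ContDiffOn ℝ ∞ F V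
  metric : ∀ v ∈ V, ∀ α β, pd3 F 0 α β v = η α β
  det_ne_zero : η.det ≠ 0
  wdvv : ∀ v ∈ V, ∀ α β ν μ,
    ∑ ξ, ∑ σ, pd3 F α β ξ v * η⁻¹ ξ σ * pd3 F σ ν μ v
      = ∑ ξ, ∑ σ, pd3 F μ β ξ v * η⁻¹ ξ σ * pd3 F σ ν α v
  euler : ∃ (A : Matrix (Fin r) (Fin r) ℝ) (B : Fin r → ℝ) (C : ℝ), ∀ v ∈ V,
    ∑ α, (q α * v α + ρ α) * pd α F v
      = (3 - d) * F v + (∑ α, ∑ β, A α β * v α * v β + ∑ α, B α * v α + C)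

/-- The intersection form
`g^{αβ} = ∑ (q_σ v^σ + ρ_σ) η^{αγ} η^{βν} ∂³F/∂v^σ∂v^γ∂v^ν`. -/
noncomputable def intersectionForm {r : ℕ} (F : (Fin r → ℝ) → ℝ)
    (η : Matrix (Fin r) (Fin r) ℝ) (q ρ : Fin r → ℝ) (v : Fin r → ℝ) :
    Matrix (Fin r) (Fin r) ℝ :=
  Matrix.of fun α β => ∑ σ, ∑ γ, ∑ ν,
    (q σ * v σ + ρ σ) * η⁻¹ α γ * η⁻¹ β ν * pd3 F σ γ ν v

/-- The Christoffel symbols `Γ^β_{νγ}` of the Levi-Civita connection of the metric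
`(g_{αβ}) = (g^{αβ})⁻¹`, given the contravariant metric `g = (g^{αβ})`. -/
noncomputable def christoffel {r : ℕ} (g : (Fin r → ℝ) → Matrix (Fin r) (Fin r) ℝ)
    (β ν γ : Fin r) (v : Fin r → ℝ) : ℝ :=
  1 / 2 * ∑ δ, g v β δ *
    (pd ν (fun u => (g u)⁻¹ δ γ) v + pd γ (fun u => (g u)⁻¹ δ ν) v
      - pd δ (fun u => (g u)⁻¹ ν γ) v)

/-- The operator of hydrodynamic type `g^{αβ}(v) ∂ₓ + ∑ Γ^{αβ}_γ(v) v^γ_x` with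
`Γ^{αβ}_γ = - ∑ g^{αν} Γ^β_{νγ}` attached to a contravariant metric `g`. -/
noncomputable def hydroOp {r : ℕ} (g : (Fin r → ℝ) → Matrix (Fin r) (Fin r) ℝ) : LoopOp r :=
  fun v ξ x α => ∑ β, (g (v x) α β * deriv (fun y => ξ y β) x
    + (∑ γ, (-∑ ν, g (v x) α ν * christoffel g β ν γ (v x)) * deriv (fun y => v y γ) x) * ξ x β)

/-- `P_fm^{αβ} = η^{αβ} ∂ₓ`. -/
noncomputable def frobP {r : ℕ} (η : Matrix (Fin r) (Fin r) ℝ) : LoopOp r :=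
  fun _ ξ x α => ∑ β, η⁻¹ α β * deriv (fun y => ξ y β) x

/-- `Q_fm^{αβ} = g^{αβ}(v) ∂ₓ + Γ^{αβ}_γ v^γ_x`, with `g` the intersection form. -/
noncomputable def frobQ {r : ℕ} (F : (Fin r → ℝ) → ℝ) (η : Matrix (Fin r) (Fin r) ℝ)
    (q ρ : Fin r → ℝ) : LoopOp r :=
  hydroOp (intersectionForm F η q ρ)

/-! ### Comparison of the two pairs of operators -/

/-- The Jacobian matrix `∂v^α/∂w^i` of a change of coordinates `w ↦ v(w)`. -/
noncomputable def jacobian {r : ℕ} (v : (Fin r → ℝ) → Fin r → ℝ) (w : Fin r → ℝ) :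
    Matrix (Fin r) (Fin r) ℝ :=
  Matrix.of fun α i => pd i (fun u => v u α) w

/-- `w ↦ v(w)` is a smooth change of coordinates on `U` (a diffeomorphism onto `v(U)`). -/
structure IsCoordChange {r : ℕ} (U : Set (Fin r → ℝ)) (v : (Fin r → ℝ) → Fin r → ℝ) : Prop where
  smooth : ContDiffOn ℝ ∞ v U
  injOn : Set.InjOn v U
  det_ne_zero : ∀ w ∈ U, (jacobian v w).det ≠ 0

/-- The operator `P`, written in the coordinates `w`, becomes the operator `P'` in the coordinates
`v = v(w)`: `P'^{αβ} = ∑ (∂v^α/∂w^i) ∘ P^{ij} ∘ (∂v^β/∂w^j)`, as operators acting on smooth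
covector functions along every smooth loop `S¹ = ℝ/ℤ → U`. -/
def Becomes {r : ℕ} (U : Set (Fin r → ℝ)) (v : (Fin r → ℝ) → Fin r → ℝ)
    (P P' : LoopOp r) : Prop :=
  ∀ w ξ : ℝ → Fin r → ℝ, ContDiff ℝ ∞ w → Function.Periodic w 1 → (∀ x, w x ∈ U) →
    ContDiff ℝ ∞ ξ → Function.Periodic ξ 1 → ∀ x α,
      P' (fun y => v (w y)) ξ x α
        = ∑ i, jacobian v (w x) α i *
            P w (fun y j => ∑ β, jacobian v (w y) β j * ξ y β) x i

/-- On `U`, in the coordinates `v = v(w)`, the leading term of `B_{k,l} = (P_k, P_l)` is the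
bihamiltonian structure `(P_fm, Q_fm)` of the Frobenius manifold with potential `F`, flat
coordinates `v`, metric `η`, Euler vector field `∑ (q_α v^α + ρ_α) ∂/∂v^α` and charge `d`. -/
structure IsGivenBy {r : ℕ} [NeZero r] (a : Fin (r + 1) → ℝ) (k l : ℕ) (U : Set (Fin r → ℝ))
    (v : (Fin r → ℝ) → Fin r → ℝ) (F : (Fin r → ℝ) → ℝ) (η : Matrix (Fin r) (Fin r) ℝ)
    (q ρ : Fin r → ℝ) (d : ℝ) : Prop where
  coord : IsCoordChange U v
  frobenius : IsFrobenius (v '' U) F η q ρ d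
  first : Becomes U v (leadingTerm (hamP a k)) (frobP η)
  second : Becomes U v (leadingTerm (hamP a l)) (frobQ F η q ρ)

end RKdVCH

open RKdVCH

namespace RKdVCH

/-! ### Partial derivatives of smooth functions -/

/-! Necessity rests on the unit field e = ∂/∂v^1. In flat coordinates L_e annihilates the constant
metric η⁻¹ and sends the intersection form to q η⁻¹, with q the coefficient of v^1 in the first
component of the Euler field (`IsFrobenius.pd_zero_intersectionForm`). In the coordinates w this
reads L_e g_k = 0 and L_e g_l = q g_k.

Write W(λ) = λ^r + w^{r-1} λ^{r-1} + ⋯ + w^0 and E(λ) = ∑ e^i λ^i. The metrics have generating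
function 2 (x^m W(y) - y^m W(x)) / (x - y) (`metricP_generating`). At a root z of W the covector ζ =
(z^j) is therefore a common eigencovector: z^k g_l ζ = z^l g_k ζ. It is proportional to dz, so the
roots diagonalize the pencil. Contracting both Lie equations twice with ζ gives algebraic relations
between E, W and q at z (`root_relations`). Hence W divides N = (l - k) λ^a E + q λ^b W' whenever a
+ k + 1 = b + l. Differentiating N = A W in w along g_k ζ yields z A(z) = q (l - 1) z^b at each root
(`quotient_at_root`).

Since the r roots are distinct, a degree count now decides (k, l). If k < l, take b = 0: λ A - q (l
- 1) has degree below r, so it is zero and l = 1. If l < k, take a = 0: comparison of leading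
coefficients leaves only (r, 0), and the next coefficient excludes that too.

For (0, 1) the same relation gives E = -q W' exactly. The covector obtained by lowering e with g_0
must be the differential of η_{1α} v^α, and equality of mixed second derivatives fails when r ≥ 3
(`le_two_of_closed`).

Conversely, for r = 1, 2 a one-parameter family of explicit potentials is verified directly
(`isGivenBy_one`, `isGivenBy_two`). Its parameter c rescales v^1, which covers both the stated
potentials and the normalization of the Euler field. -/

theorem pd_contDiffOn {r : ℕ} {V : Set (Fin r → ℝ)} (hV : IsOpen V) {f : (Fin r → ℝ) → ℝ}
    (hf : ContDiffOn ℝ ∞ f V) (α : Fin r) : ContDiffOn ℝ ∞ (pd α f) V :=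
  (hf.fderiv_of_isOpen hV (m := ∞) (by simp)).clm_apply contDiffOn_const

theorem differentiableAt_of_smooth {r : ℕ} {V : Set (Fin r → ℝ)} (hV : IsOpen V)
    {f : (Fin r → ℝ) → ℝ} (hf : ContDiffOn ℝ ∞ f V) {v : Fin r → ℝ} (hv : v ∈ V) :
    DifferentiableAt ℝ f v :=
  (hf.differentiableOn (by simp)).differentiableAt (hV.mem_nhds hv)

theorem pd_congr {r : ℕ} {V : Set (Fin r → ℝ)} (hV : IsOpen V) {f g : (Fin r → ℝ) → ℝ}
    (h : Set.EqOn f g V) {v : Fin r → ℝ} (hv : v ∈ V) (α : Fin r) : pd α f v = pd α g v := by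
  have : f =ᶠ[nhds v] g := Filter.eventuallyEq_of_mem (hV.mem_nhds hv) h
  simp only [pd, this.fderiv_eq]

theorem pd_comm {r : ℕ} {V : Set (Fin r → ℝ)} (hV : IsOpen V) {f : (Fin r → ℝ) → ℝ}
    (hf : ContDiffOn ℝ ∞ f V) {v : Fin r → ℝ} (hv : v ∈ V) (α β : Fin r) :
    pd α (pd β f) v = pd β (pd α f) v := by
  have hd : DifferentiableAt ℝ (fderiv ℝ f) v :=
    ((hf.fderiv_of_isOpen hV (m := ∞) (by simp)).differentiableOn (by simp)).differentiableAt
      (hV.mem_nhds hv)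
  have key : ∀ a b : Fin r, pd a (pd b f) v
      = fderiv ℝ (fderiv ℝ f) v (Pi.single a 1) (Pi.single b 1) := by
    intro a b
    have : pd b f = fun u => fderiv ℝ f u (Pi.single b 1) := rfl
    rw [this, pd, fderiv_clm_apply hd (differentiableAt_const _)]
    simp
  rw [key, key]
  have hs : IsSymmSndFDerivAt ℝ f v :=
    (hf.contDiffAt (hV.mem_nhds hv)).isSymmSndFDerivAt (by simpa using ENat.LEInfty.out)
  exact hs.eq _ _

theorem fderiv_eq_sum_pd {r : ℕ} (f : (Fin r → ℝ) → ℝ) (v u : Fin r → ℝ) :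
    fderiv ℝ f v u = ∑ p, u p * pd p f v := by
  conv_lhs => rw [← Finset.univ_sum_single u]
  rw [map_sum]
  refine Finset.sum_congr rfl fun p _ => ?_
  rw [pd, ← smul_eq_mul, ← map_smul]
  congr 1
  ext i
  simp [Pi.single_apply]

/-- Differentiation of `f` along the straight line `w + t u`. -/
theorem hasDerivAt_line {r : ℕ} {f : (Fin r → ℝ) → ℝ} {w : Fin r → ℝ}
    (hf : DifferentiableAt ℝ f w) (u : Fin r → ℝ) :
    HasDerivAt (fun t : ℝ => f (w + t • u)) (∑ p, u p * pd p f w) 0 := by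
  rw [← fderiv_eq_sum_pd]
  have h1 : HasDerivAt (fun t : ℝ => w + t • u) u 0 := by
    simpa using ((hasDerivAt_id (0 : ℝ)).smul_const u).const_add w
  have h2 : HasFDerivAt f (fderiv ℝ f w) (w + (0 : ℝ) • u) := by simpa using hf.hasFDerivAt
  exact h2.comp_hasDerivAt 0 h1

theorem hasDerivAt_matrix_mul {l m n : Type*} [Fintype m] {A : ℝ → Matrix l m ℝ}
    {B : ℝ → Matrix m n ℝ} {A' : Matrix l m ℝ} {B' : Matrix m n ℝ} {t : ℝ}
    (hA : ∀ i j, HasDerivAt (fun s => A s i j) (A' i j) t)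
    (hB : ∀ i j, HasDerivAt (fun s => B s i j) (B' i j) t) (i : l) (j : n) :
    HasDerivAt (fun s => (A s * B s) i j) ((A' * B t + A t * B') i j) t := by
  simp only [Matrix.mul_apply, Matrix.add_apply, ← Finset.sum_add_distrib]
  exact HasDerivAt.fun_sum fun p _ => (hA i p).mul (hB p j)

/-! ### The intersection form along the unit vector field -/

section Frobenius

variable {r : ℕ} [NeZero r] {V : Set (Fin r → ℝ)} {F : (Fin r → ℝ) → ℝ}
  {η : Matrix (Fin r) (Fin r) ℝ} {q ρ : Fin r → ℝ} {d : ℝ}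

theorem IsFrobenius.pd3_contDiffOn (h : IsFrobenius V F η q ρ d) (α β γ : Fin r) :
    ContDiffOn ℝ ∞ (pd3 F α β γ) V :=
  pd_contDiffOn h.isOpen (pd_contDiffOn h.isOpen (pd_contDiffOn h.isOpen h.smooth γ) β) α

theorem IsFrobenius.eta_symm (h : IsFrobenius V F η q ρ d) (hV : V.Nonempty) (α β : Fin r) :
    η α β = η β α := by
  obtain ⟨v, hv⟩ := hV
  rw [← h.metric v hv, ← h.metric v hv]
  exact pd_congr h.isOpen (fun u hu => pd_comm h.isOpen h.smooth hu α β) hv 0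

theorem IsFrobenius.pd_zero_pd3 (h : IsFrobenius V F η q ρ d) {v : Fin r → ℝ} (hv : v ∈ V)
    (α β γ : Fin r) : pd 0 (pd3 F α β γ) v = 0 := by
  have h2 := pd_contDiffOn h.isOpen (pd_contDiffOn h.isOpen h.smooth γ) β
  have : pd 0 (pd3 F α β γ) v = pd α (pd3 F 0 β γ) v := pd_comm h.isOpen h2 hv 0 α
  rw [this, pd_congr h.isOpen (g := fun _ => η β γ) (fun u hu => h.metric u hu β γ) hv]
  simp [pd]

theorem IsFrobenius.intersectionForm_differentiableAt (h : IsFrobenius V F η q ρ d)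
    {v : Fin r → ℝ} (hv : v ∈ V) (α β : Fin r) :
    DifferentiableAt ℝ (fun u => intersectionForm F η q ρ u α β) v := by
  have := fun σ γ ν => differentiableAt_of_smooth h.isOpen (h.pd3_contDiffOn σ γ ν) hv
  simp only [intersectionForm, Matrix.of_apply]
  fun_prop

/-- Constancy of η means that ∂_1 kills every third derivative of F. Only the explicit dependence of
the Euler field on v^1 survives, contributing q_1 times η with both indices raised. -/
theorem IsFrobenius.pd_zero_intersectionForm (h : IsFrobenius V F η q ρ d)
    {v : Fin r → ℝ} (hv : v ∈ V) (α β : Fin r) :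
    pd 0 (fun u => intersectionForm F η q ρ u α β) v = q 0 * η⁻¹ α β := by
  have hd := fun σ γ ν => differentiableAt_of_smooth h.isOpen (h.pd3_contDiffOn σ γ ν) hv
  have hF : ∀ σ γ ν, HasDerivAt (fun t : ℝ => pd3 F σ γ ν (v + t • Pi.single 0 1)) 0 0 := by
    intro σ γ ν
    have := hasDerivAt_line (hd σ γ ν) (Pi.single 0 1)
    simpa [Pi.single_apply, h.pd_zero_pd3 hv] using this
  have hL := hasDerivAt_line (h.intersectionForm_differentiableAt hv α β) (Pi.single 0 1)
  have hl : ∀ σ, HasDerivAt (fun t : ℝ => q σ * (v + t • Pi.single 0 1 : Fin r → ℝ) σ + ρ σ)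
      (q σ * (Pi.single 0 1 : Fin r → ℝ) σ) 0 := by
    intro σ
    have : HasDerivAt (fun t : ℝ => v σ + t * (Pi.single 0 1 : Fin r → ℝ) σ)
        ((Pi.single 0 1 : Fin r → ℝ) σ) 0 := by
      simpa using ((hasDerivAt_id (0 : ℝ)).mul_const ((Pi.single 0 1 : Fin r → ℝ) σ)).const_add (v σ)
    simpa using (this.const_mul (q σ)).add_const (ρ σ)
  have hR : HasDerivAt (fun t : ℝ => intersectionForm F η q ρ (v + t • Pi.single 0 1) α β)
      (∑ σ, ∑ γ, ∑ ν, (q σ * (Pi.single 0 1 : Fin r → ℝ) σ) * η⁻¹ α γ * η⁻¹ β ν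
        * pd3 F σ γ ν v) 0 := by
    simp only [intersectionForm, Matrix.of_apply]
    refine HasDerivAt.fun_sum fun σ _ => HasDerivAt.fun_sum fun γ _ => HasDerivAt.fun_sum
      fun ν _ => ?_
    simpa using (((hl σ).mul_const (η⁻¹ α γ)).mul_const (η⁻¹ β ν)).fun_mul (hF σ γ ν)
  have e := hL.unique hR
  simp only [Pi.single_apply, ite_mul, mul_ite, one_mul, zero_mul, mul_one, mul_zero,
    Finset.sum_ite_irrel, Finset.sum_const_zero, Finset.sum_ite_eq', Finset.mem_univ, if_true] at e
  rw [e]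
  have hs := h.eta_symm ⟨v, hv⟩
  have hu : IsUnit η.det := isUnit_iff_ne_zero.mpr h.det_ne_zero
  have : ∀ γ, ∑ ν, q 0 * η⁻¹ α γ * η⁻¹ β ν * pd3 F 0 γ ν v
      = q 0 * η⁻¹ α γ * (1 : Matrix (Fin r) (Fin r) ℝ) β γ := by
    intro γ
    rw [← Matrix.nonsing_inv_mul η hu, Matrix.mul_apply, Finset.mul_sum]
    exact Finset.sum_congr rfl fun ν _ => by rw [h.metric v hv, hs γ ν]; ring
  simp only [this, Matrix.one_apply]
  simp

end Frobenius

/-! ### The metrics of the two structures in the flat coordinates -/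

theorem hamP_const {r : ℕ} (a : Fin (r + 1) → ℝ) (m : ℕ) (w : Fin r → ℝ)
    (ξ : ℝ → Fin r → ℝ) (x : ℝ) (i : Fin r) :
    leadingTerm (hamP a m) (fun _ => w) ξ x i
      = ∑ j, metricP r m w i j * deriv (fun y => ξ y j) x := by
  simp only [leadingTerm, hamP, opD, metricP, Matrix.of_apply]
  refine Finset.sum_congr rfl fun j _ => ?_
  simp
  ring

/-- Constant loops suppress the terms in w_x, so comparing the operators there compares their
coefficients of ∂ₓ. -/
theorem Becomes.metric_eq {r : ℕ} {U : Set (Fin r → ℝ)} {v : (Fin r → ℝ) → Fin r → ℝ}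
    {a : Fin (r + 1) → ℝ} {m : ℕ} {P' : LoopOp r} {g' : Matrix (Fin r) (Fin r) ℝ}
    (h : Becomes U v (leadingTerm (hamP a m)) P') {w : Fin r → ℝ} (hw : w ∈ U)
    (hP' : ∀ ξ x α, P' (fun _ => v w) ξ x α = ∑ β, g' α β * deriv (fun y => ξ y β) x) :
    jacobian v w * metricP r m w * (jacobian v w).transpose = g' := by
  ext α β
  -- A 1-periodic smooth function with derivative 1 at 0; multiplied by a basis covector it isolates
  -- one column of the metric.
  let s : ℝ → ℝ := fun y => Real.sin (2 * Real.pi * y) / (2 * Real.pi)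
  have hs : ∀ c : ℝ, deriv (fun y => c * s y) 0 = c := by
    intro c
    have h1 : HasDerivAt (fun y : ℝ => 2 * Real.pi * y) (2 * Real.pi) 0 := by
      simpa using (hasDerivAt_id (0 : ℝ)).const_mul (2 * Real.pi)
    have h2 : HasDerivAt s 1 0 := by
      have := (h1.sin).div_const (2 * Real.pi)
      simpa [Real.pi_ne_zero] using this
    simpa using (h2.const_mul c).deriv
  have hsm : ContDiff ℝ ∞ s := by
    simp only [s]
    fun_prop
  have hper : ∀ y, s (y + 1) = s y := by
    intro y
    simp only [s]
    rw [mul_add, mul_one, Real.sin_add_two_pi]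
  have key := h (fun _ => w) (fun y γ => (Pi.single β (1 : ℝ) : Fin r → ℝ) γ * s y) contDiff_const
    (fun _ => rfl) (fun _ => hw)
    (contDiff_pi.mpr fun γ => contDiff_const.mul hsm)
    (fun y => by simp only [hper]) 0 α
  rw [hP'] at key
  simp only [hamP_const, hs, ← mul_assoc, ← Finset.sum_mul] at key
  simp only [Pi.single_apply, mul_ite, mul_one, mul_zero, Finset.sum_ite_eq', Finset.mem_univ,
    if_true] at key
  rw [key, Matrix.mul_apply]
  simp only [Matrix.mul_apply, Finset.sum_mul, Finset.mul_sum, Matrix.transpose_apply]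
  rw [Finset.sum_comm]
  exact Finset.sum_congr rfl fun i _ => Finset.sum_congr rfl fun j _ => by ring

/-! ### Vector fields in the coordinates `w` -/

section Field

variable {r : ℕ} {U : Set (Fin r → ℝ)} {v : (Fin r → ℝ) → Fin r → ℝ}

theorem wExt_contDiff (n : ℤ) : ContDiff ℝ ∞ fun w : Fin r → ℝ => wExt w n := by
  unfold wExt
  split_ifs <;> fun_prop

theorem IsCoordChange.component (h : IsCoordChange U v) (α : Fin r) :
    ContDiffOn ℝ ∞ (fun w => v w α) U := (contDiffOn_pi.mp h.smooth) α

theorem wExt_line (w u : Fin r → ℝ) (t : ℝ) (n : ℤ) :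
    wExt (w + t • u) n = wExt w n + t * (wExt (w + u) n - wExt w n) := by
  unfold wExt
  split_ifs <;> simp

theorem pd_eq_zero_of_eqOn_const (hU : IsOpen U) {f : (Fin r → ℝ) → ℝ} {c : ℝ}
    (h : ∀ w ∈ U, f w = c) {w : Fin r → ℝ} (hw : w ∈ U) (j : Fin r) : pd j f w = 0 := by
  rw [pd_congr hU (g := fun _ => c) h hw]
  simp [pd]

theorem line_mem (hU : IsOpen U) {w : Fin r → ℝ} (hw : w ∈ U) (u : Fin r → ℝ) :
    ∀ᶠ t : ℝ in nhds 0, w + t • u ∈ U := by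
  have : Continuous fun t : ℝ => w + t • u := by fun_prop
  exact this.continuousAt.eventually_mem (hU.mem_nhds (by simpa using hw))

theorem hasDerivAt_metricP (m : ℕ) (w u : Fin r → ℝ) (i j : Fin r) :
    HasDerivAt (fun t : ℝ => metricP r m (w + t • u) i j)
      ((metricP r m (w + u) - metricP r m w) i j) 0 := by
  simp only [metricP, Matrix.of_apply, Matrix.sub_apply]
  have h1 : HasDerivAt (fun t : ℝ => wExt (w + t • u) ((i : ℤ) + j + 1 - m))
      (wExt (w + u) ((i : ℤ) + j + 1 - m) - wExt w ((i : ℤ) + j + 1 - m)) 0 := by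
    have := ((hasDerivAt_id (0 : ℝ)).mul_const
      (wExt (w + u) ((i : ℤ) + j + 1 - m) - wExt w ((i : ℤ) + j + 1 - m))).const_add
      (wExt w ((i : ℤ) + j + 1 - m))
    simp only [one_mul] at this
    simp only [wExt_line]
    exact this
  have h2 := h1.const_mul (2 * coeffF m i j)
  rwa [mul_sub] at h2

/-- The matrix `∂e^i/∂w^j` of a vector field `e`. -/
noncomputable def gradField (e : (Fin r → ℝ) → Fin r → ℝ) (w : Fin r → ℝ) :
    Matrix (Fin r) (Fin r) ℝ := Matrix.of fun i j => pd j (fun u => e u i) w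

/-- The Lie derivative of the contravariant metric `g_m` along `e`; as `g_m` is affine in `w`, its
derivative along `e w` is `g_m(w + e w) - g_m(w)`. -/
noncomputable def lieMetric (m : ℕ) (e : (Fin r → ℝ) → Fin r → ℝ) (w : Fin r → ℝ) :
    Matrix (Fin r) (Fin r) ℝ :=
  metricP r m (w + e w) - metricP r m w - gradField e w * metricP r m w
    - metricP r m w * (gradField e w).transpose

end Field

/-! ### The unit vector field in the coordinates `w` -/

section Unit

variable {r : ℕ} [NeZero r] {a : Fin (r + 1) → ℝ} {k l : ℕ} {U : Set (Fin r → ℝ)}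
  {v : (Fin r → ℝ) → Fin r → ℝ} {F : (Fin r → ℝ) → ℝ} {η : Matrix (Fin r) (Fin r) ℝ}
  {q ρ : Fin r → ℝ} {d : ℝ}

theorem IsGivenBy.first_metric (h : IsGivenBy a k l U v F η q ρ d) {w : Fin r → ℝ} (hw : w ∈ U) :
    jacobian v w * metricP r k w * (jacobian v w).transpose = η⁻¹ :=
  h.first.metric_eq hw fun _ _ _ => rfl

theorem IsGivenBy.second_metric (h : IsGivenBy a k l U v F η q ρ d) {w : Fin r → ℝ}
    (hw : w ∈ U) :
    jacobian v w * metricP r l w * (jacobian v w).transpose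
      = intersectionForm F η q ρ (v w) :=
  h.second.metric_eq hw fun ξ x α => by simp [frobQ, hydroOp]

/-- The flat coordinate `∑ η_{1α} v^α`, dual to the unit. -/
noncomputable def unitPotential (η : Matrix (Fin r) (Fin r) ℝ) (v : (Fin r → ℝ) → Fin r → ℝ)
    (w : Fin r → ℝ) : ℝ := ∑ α, η 0 α * v w α

/-- The unit vector field in the coordinates `w`. -/
noncomputable def unitField (k : ℕ) (η : Matrix (Fin r) (Fin r) ℝ) (v : (Fin r → ℝ) → Fin r → ℝ)
    (w : Fin r → ℝ) : Fin r → ℝ :=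
  fun i => ∑ j, metricP r k w i j * pd j (unitPotential η v) w

theorem unitPotential_contDiffOn (h : IsCoordChange U v) :
    ContDiffOn ℝ ∞ (unitPotential η v) U :=
  ContDiffOn.sum fun α _ => contDiffOn_const.mul (h.component α)

theorem unitField_contDiffOn (hU : IsOpen U) (h : IsCoordChange U v) (i : Fin r) :
    ContDiffOn ℝ ∞ (fun w => unitField k η v w i) U := by
  refine ContDiffOn.sum fun j _ => ?_
  simp only [metricP, Matrix.of_apply]
  exact (contDiff_const.mul (wExt_contDiff _)).contDiffOn.mul
    (pd_contDiffOn hU (unitPotential_contDiffOn h) j)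

theorem pd_unitPotential (hU : IsOpen U) (h : IsCoordChange U v) {w : Fin r → ℝ} (hw : w ∈ U)
    (j : Fin r) : pd j (unitPotential η v) w = ∑ α, η 0 α * jacobian v w α j := by
  have hd := fun α => differentiableAt_of_smooth hU (h.component α) hw
  have : HasFDerivAt (unitPotential η v) (∑ α, η 0 α • fderiv ℝ (fun w => v w α) w) w := 
    HasFDerivAt.fun_sum fun α _ => (hd α).hasFDerivAt.const_mul (η 0 α)
  rw [pd, this.fderiv]
  simp [jacobian, pd]

/-- The gradient of η_{1α} v^α for the flat metric is ∂/∂v^1. Presenting e as a gradient is what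
later supplies the closedness condition. -/
theorem IsGivenBy.jacobian_unitField (h : IsGivenBy a k l U v F η q ρ d) (hU : IsOpen U)
    {w : Fin r → ℝ} (hw : w ∈ U) (α : Fin r) :
    ∑ i, jacobian v w α i * unitField k η v w i = (Pi.single 0 1 : Fin r → ℝ) α := by
  have hu : IsUnit η.det := isUnit_iff_ne_zero.mpr h.frobenius.det_ne_zero
  have e : (jacobian v w * metricP r k w * (jacobian v w).transpose * η.transpose) α 0
      = (Pi.single 0 1 : Fin r → ℝ) α := by
    have hs : η.transpose = η := by
      ext i j
      exact h.frobenius.eta_symm ⟨_, w, hw, rfl⟩ j i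
    rw [h.first_metric hw, hs, Matrix.nonsing_inv_mul _ hu, Matrix.one_apply, Pi.single_apply]
  rw [← e, Matrix.mul_assoc, Matrix.mul_assoc, Matrix.mul_apply]
  refine Finset.sum_congr rfl fun i _ => ?_
  rw [unitField, Matrix.mul_apply]
  congr 1
  refine Finset.sum_congr rfl fun j _ => ?_
  rw [pd_unitPotential hU h.coord hw, Matrix.mul_apply]
  congr 1
  exact Finset.sum_congr rfl fun β _ => by simp [mul_comm]

/-- The vector J e is constant. Differentiating it in w^i and exchanging second derivatives of v
turns the derivative of J along e into -J ∂e. -/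
theorem IsGivenBy.hasDerivAt_jacobian (h : IsGivenBy a k l U v F η q ρ d) (hU : IsOpen U)
    {w : Fin r → ℝ} (hw : w ∈ U) (α i : Fin r) :
    HasDerivAt (fun t : ℝ => jacobian v (w + t • unitField k η v w) α i)
      ((-(jacobian v w * gradField (unitField k η v) w)) α i) 0 := by
  have hc : ∀ α i, ContDiffOn ℝ ∞ (fun w => jacobian v w α i) U := fun α i =>
    pd_contDiffOn hU (h.coord.component α) i
  have hd : ∀ α i, DifferentiableAt ℝ (fun w => jacobian v w α i) w := fun α i =>
    differentiableAt_of_smooth hU (hc α i) hw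
  have he : ∀ i, DifferentiableAt ℝ (fun w => unitField k η v w i) w := fun i =>
    differentiableAt_of_smooth hU (unitField_contDiffOn hU h.coord i) hw
  convert hasDerivAt_line (hd α i) (unitField k η v w) using 1
  have h0 := pd_eq_zero_of_eqOn_const hU (fun w hw => h.jacobian_unitField hU hw α) hw i
  have h1 : HasFDerivAt (fun w => ∑ p, jacobian v w α p * unitField k η v w p)
      (∑ p, (jacobian v w α p • fderiv ℝ (fun w => unitField k η v w p) w
        + unitField k η v w p • fderiv ℝ (fun w => jacobian v w α p) w)) w :=
    HasFDerivAt.fun_sum fun p _ => (hd α p).hasFDerivAt.fun_mul (he p).hasFDerivAt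
  rw [pd, h1.fderiv] at h0
  have hsymm : ∀ p, pd i (fun w => jacobian v w α p) w = pd p (fun w => jacobian v w α i) w :=
    fun p => pd_comm hU (h.coord.component α) hw i p
  simp only [pd] at hsymm
  simp only [sum_apply, add_apply,
    smul_apply, smul_eq_mul, Finset.sum_add_distrib, hsymm] at h0
  simp only [Matrix.neg_apply, Matrix.mul_apply, gradField, Matrix.of_apply, pd]
  linarith

/-- A Lie derivative is the derivative of the components in coordinates where e is constant; the two
Jacobian factors produce its two correction terms. -/
theorem IsGivenBy.hasDerivAt_conj (h : IsGivenBy a k l U v F η q ρ d) (hU : IsOpen U)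
    {w : Fin r → ℝ} (hw : w ∈ U) (m : ℕ) (α β : Fin r) :
    HasDerivAt (fun t : ℝ => (jacobian v (w + t • unitField k η v w)
        * metricP r m (w + t • unitField k η v w)
        * (jacobian v (w + t • unitField k η v w)).transpose) α β)
      ((jacobian v w * lieMetric m (unitField k η v) w * (jacobian v w).transpose) α β) 0 := by
  have hJ := h.hasDerivAt_jacobian hU hw
  have h1 := hasDerivAt_matrix_mul hJ (hasDerivAt_metricP m w (unitField k η v w))
  have h2 := hasDerivAt_matrix_mul
    (B := fun t : ℝ => (jacobian v (w + t • unitField k η v w)).transpose)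
    (B' := (-(jacobian v w * gradField (unitField k η v) w)).transpose) h1 (fun i j => hJ j i) α β
  convert h2 using 1
  simp only [zero_smul, add_zero, lieMetric]
  simp only [Matrix.transpose_neg, Matrix.transpose_mul]
  noncomm_ring

theorem IsGivenBy.isUnit_jacobian (h : IsGivenBy a k l U v F η q ρ d) {w : Fin r → ℝ}
    (hw : w ∈ U) : IsUnit (jacobian v w) :=
  (Matrix.isUnit_iff_isUnit_det _).mpr (isUnit_iff_ne_zero.mpr (h.coord.det_ne_zero w hw))

theorem IsGivenBy.conj_injective (h : IsGivenBy a k l U v F η q ρ d) {w : Fin r → ℝ}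
    (hw : w ∈ U) {A B : Matrix (Fin r) (Fin r) ℝ}
    (e : jacobian v w * A * (jacobian v w).transpose
      = jacobian v w * B * (jacobian v w).transpose) : A = B := by
  have hu := h.isUnit_jacobian hw
  have hut : IsUnit (jacobian v w).transpose := by
    rw [Matrix.isUnit_iff_isUnit_det, Matrix.det_transpose, ← Matrix.isUnit_iff_isUnit_det]
    exact hu
  exact hu.mul_left_cancel (hut.mul_right_cancel e)

theorem IsGivenBy.lieMetric_left (h : IsGivenBy a k l U v F η q ρ d) (hU : IsOpen U)
    {w : Fin r → ℝ} (hw : w ∈ U) : lieMetric k (unitField k η v) w = 0 := by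
  refine h.conj_injective hw ?_
  ext α β
  have h1 := h.hasDerivAt_conj hU hw k α β
  have h2 : HasDerivAt (fun _ : ℝ => η⁻¹ α β) 0 0 := hasDerivAt_const _ _
  rw [h1.unique (h2.congr_of_eventuallyEq 
    ((line_mem hU hw (unitField k η v w)).mono fun t ht =>
      congrFun (congrFun (h.first_metric ht) α) β))]
  simp

/-- Both sides are conjugated by the Jacobian to flat coordinates, where the equality is
`IsFrobenius.pd_zero_intersectionForm`. -/
theorem IsGivenBy.lieMetric_right (h : IsGivenBy a k l U v F η q ρ d) (hU : IsOpen U)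
    {w : Fin r → ℝ} (hw : w ∈ U) :
    lieMetric l (unitField k η v) w = q 0 • metricP r k w := by
  refine h.conj_injective hw ?_
  ext α β
  have h1 := h.hasDerivAt_conj hU hw l α β
  have hv : v w ∈ v '' U := ⟨w, hw, rfl⟩
  have hg := h.frobenius.intersectionForm_differentiableAt hv α β
  have hl : HasDerivAt (fun t : ℝ => v (w + t • unitField k η v w)) (Pi.single 0 1) 0 := by
    rw [hasDerivAt_pi]
    intro γ
    rw [← h.jacobian_unitField hU hw γ]
    have := hasDerivAt_line (differentiableAt_of_smooth hU (h.coord.component γ) hw)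
      (unitField k η v w)
    simp only [mul_comm (unitField k η v w _)] at this
    exact this
  have h2 : HasDerivAt (fun t : ℝ => intersectionForm F η q ρ (v (w + t • unitField k η v w)) α β)
      (q 0 * η⁻¹ α β) 0 := by
    rw [← h.frobenius.pd_zero_intersectionForm hv α β]
    have hg' : HasFDerivAt (fun u => intersectionForm F η q ρ u α β)
      (fderiv ℝ (fun u => intersectionForm F η q ρ u α β) (v w))
      (v (w + (0 : ℝ) • unitField k η v w)) := by simpa using hg.hasFDerivAt
    exact hg'.comp_hasDerivAt 0 hl
  rw [h1.unique (h2.congr_of_eventuallyEq 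
    ((line_mem hU hw (unitField k η v w)).mono fun t ht =>
      congrFun (congrFun (h.second_metric ht) α) β)), Matrix.mul_smul, Matrix.smul_mul, h.first_metric hw]
  simp

theorem IsGivenBy.unitField_ne_zero (h : IsGivenBy a k l U v F η q ρ d) (hU : IsOpen U)
    {w : Fin r → ℝ} (hw : w ∈ U) : unitField k η v w ≠ 0 := by
  intro e
  have := h.jacobian_unitField hU hw 0
  simp [e] at this

end Unit

/-! ### Generating functions of the metrics -/

open Polynomial in
/-- The polynomial `∑ c_i λ^i`. -/
noncomputable def polyV {r : ℕ} (c : Fin r → ℂ) : ℂ[X] := ∑ i : Fin r, C (c i) * X ^ (i : ℕ)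

section Poly

open Polynomial

variable {r : ℕ}

theorem polyV_degree_lt (c : Fin r → ℂ) : (polyV c).degree < r := by
  refine mem_degreeLT.mp (Submodule.sum_mem _ fun i _ => mem_degreeLT.mpr ?_)
  exact (degree_C_mul_X_pow_le _ _).trans_lt (by exact_mod_cast i.2)

theorem polyW_eq (w : Fin r → ℝ) : polyW w = X ^ r + polyV fun i => ((w i : ℝ) : ℂ) := rfl

theorem polyW_monic (w : Fin r → ℝ) : (polyW w).Monic := by
  rw [polyW_eq]
  exact monic_X_pow_add (polyV_degree_lt _)

theorem polyW_degree (w : Fin r → ℝ) : (polyW w).degree = r := by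
  rw [polyW_eq, degree_add_eq_left_of_degree_lt, degree_X_pow]
  rw [degree_X_pow]
  exact polyV_degree_lt _

theorem polyW_natDegree (w : Fin r → ℝ) : (polyW w).natDegree = r :=
  natDegree_eq_of_degree_eq_some (polyW_degree w)

theorem polyV_coeff (c : Fin r → ℂ) (i : Fin r) : (polyV c).coeff i = c i := by
  simp [polyV, coeff_X_pow, Fin.val_inj]

theorem polyV_eval (c : Fin r → ℂ) (x : ℂ) : (polyV c).eval x = ∑ i, c i * x ^ (i : ℕ) := by
  simp [polyV, eval_finsetSum]

theorem polyW_add (w u : Fin r → ℝ) :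
    polyW (w + u) = polyW w + polyV fun i => ((u i : ℝ) : ℂ) := by
  simp only [polyW_eq, polyV, Pi.add_apply, Complex.ofReal_add, C_add, add_mul,
    Finset.sum_add_distrib, add_assoc]

theorem polyW_eval (w : Fin r → ℝ) (x : ℂ) :
    (polyW w).eval x = ∑ s ∈ Finset.range r, (wExt w s : ℂ) * x ^ s + x ^ r := by
  rw [polyW_eq, eval_add, polyV_eval, eval_pow, eval_X, add_comm,
    ← Fin.sum_univ_eq_sum_range (fun s => (wExt w s : ℂ) * x ^ s)]
  congr 1
  refine Finset.sum_congr rfl fun i _ => ?_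
  simp [wExt]

theorem wExt_neg (w : Fin r → ℝ) {n : ℤ} (h : n < 0) : wExt w n = 0 := by
  rw [wExt, dif_neg (by omega), if_neg (by omega)]

theorem wExt_top (w : Fin r → ℝ) : wExt w r = 1 := by
  rw [wExt, dif_neg (by omega), if_pos rfl]

theorem wExt_gt (w : Fin r → ℝ) {n : ℤ} (h : (r : ℤ) < n) : wExt w n = 0 := by
  rw [wExt, dif_neg (by omega), if_neg (by omega)]

theorem sum_sum_telescope (u : ℕ → ℕ → ℂ) (n : ℕ) :
    ∑ i ∈ Finset.range n, ∑ j ∈ Finset.range n, (u (i + 1) j - u i (j + 1))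
      = ∑ j ∈ Finset.range n, (u n j - u 0 j + (u j 0 - u j n)) := by
  have h : ∀ i j, u (i + 1) j - u i (j + 1) = (u (i + 1) j - u i j) + (u i j - u i (j + 1)) :=
    fun i j => by ring
  simp only [h, Finset.sum_add_distrib]
  congr 1
  · rw [Finset.sum_comm]
    exact Finset.sum_congr rfl fun j _ => Finset.sum_range_sub (fun i => u i j) n
  · exact Finset.sum_congr rfl fun i _ => Finset.sum_range_sub' (fun j => u i j) n

/-- The entry of g_m depends on i + j only within each of the blocks i, j < m and i, j ≥ m, so
multiplication by x - y makes each block telescope. The boundary terms assemble into W(x) and W(y),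
the opposite signs of the blocks matching the two truncations of W. -/
theorem metricP_generating {m : ℕ} (hm : m ≤ r) (w : Fin r → ℝ) (x y : ℂ) :
    (x - y) * ∑ i : Fin r, ∑ j : Fin r, (metricP r m w i j : ℂ) * x ^ (i : ℕ) * y ^ (j : ℕ)
      = 2 * (x ^ m * (polyW w).eval y - y ^ m * (polyW w).eval x) := by
  obtain ⟨M, rfl⟩ := Nat.exists_eq_add_of_le hm
  have h0 : ∑ i : Fin (m + M), ∑ j : Fin (m + M),
      (metricP (m + M) m w i j : ℂ) * x ^ (i : ℕ) * y ^ (j : ℕ)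
      = ∑ i ∈ Finset.range (m + M), ∑ j ∈ Finset.range (m + M),
        ((2 * coeffF m i j * wExt w ((i : ℤ) + j + 1 - m) : ℝ) : ℂ) * x ^ i * y ^ j := by
    rw [← Fin.sum_univ_eq_sum_range (fun i => ∑ j ∈ Finset.range (m + M),
        ((2 * coeffF m i j * wExt w ((i : ℤ) + j + 1 - m) : ℝ) : ℂ) * x ^ i * y ^ j)]
    refine Finset.sum_congr rfl fun i _ => ?_
    rw [← Fin.sum_univ_eq_sum_range (fun j =>
        ((2 * coeffF m i j * wExt w ((i : ℤ) + j + 1 - m) : ℝ) : ℂ) * x ^ (i : ℕ) * y ^ j)]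
    simp [metricP]
  have h1 := sum_sum_telescope
    (fun i j => (wExt w ((i : ℤ) + j - m) : ℂ) * x ^ i * y ^ j) m
  have h2 := sum_sum_telescope
    (fun i j => (wExt w ((m : ℤ) + i + j) : ℂ) * x ^ (m + i) * y ^ (m + j)) M
  have e1 : ∀ j ∈ Finset.range m,
      ((wExt w ((m : ℤ) + j - m) : ℂ) * x ^ m * y ^ j
        - (wExt w (((0 : ℕ) : ℤ) + j - m) : ℂ) * x ^ 0 * y ^ j
        + ((wExt w ((j : ℤ) + (0 : ℕ) - m) : ℂ) * x ^ j * y ^ 0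
        - (wExt w ((j : ℤ) + m - m) : ℂ) * x ^ j * y ^ m))
      = x ^ m * ((wExt w j : ℂ) * y ^ j) - y ^ m * ((wExt w j : ℂ) * x ^ j) := by
    intro j hj
    rw [Finset.mem_range] at hj
    rw [wExt_neg w (n := ((0 : ℕ) : ℤ) + j - m) (by omega),
      wExt_neg w (n := (j : ℤ) + (0 : ℕ) - m) (by omega), show (m : ℤ) + j - m = j by ring,
      show (j : ℤ) + m - m = j by ring]
    push_cast
    ring
  have e2 : ∀ j ∈ Finset.range M,
      ((wExt w ((m : ℤ) + M + j) : ℂ) * x ^ (m + M) * y ^ (m + j)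
        - (wExt w ((m : ℤ) + (0 : ℕ) + j) : ℂ) * x ^ (m + 0) * y ^ (m + j)
        + ((wExt w ((m : ℤ) + j + (0 : ℕ)) : ℂ) * x ^ (m + j) * y ^ (m + 0)
        - (wExt w ((m : ℤ) + j + M) : ℂ) * x ^ (m + j) * y ^ (m + M)))
      = (if j = 0 then x ^ (m + M) * y ^ m - x ^ m * y ^ (m + M) else 0)
        - (x ^ m * ((wExt w ((m + j : ℕ) : ℤ) : ℂ) * y ^ (m + j))
        - y ^ m * ((wExt w ((m + j : ℕ) : ℤ) : ℂ) * x ^ (m + j))) := by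
    intro j hj
    -- The index m + M + j lies at r for j = 0 and beyond r otherwise, so w^r = 1 contributes
    -- exactly once.
    have ht : wExt w ((m : ℤ) + M + j) = if j = 0 then 1 else 0 := by
      split_ifs with hj0
      · have := wExt_top w
        push_cast at this
        rw [hj0, Nat.cast_zero, add_zero, this]
      · exact wExt_gt w (by push_cast; omega)
    rw [show (m : ℤ) + j + M = (m : ℤ) + M + j by ring, ht]
    split_ifs with hj0
    · subst hj0
      push_cast
      ring_nf
    · push_cast
      ring_nf
  rw [Finset.sum_congr rfl e1] at h1
  rw [Finset.sum_congr rfl e2] at h2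
  have h3 : ∑ j ∈ Finset.range M,
      (if j = 0 then x ^ (m + M) * y ^ m - x ^ m * y ^ (m + M) else 0)
      = x ^ (m + M) * y ^ m - x ^ m * y ^ (m + M) := by
    rw [Finset.sum_ite_eq' (Finset.range M) 0]
    rcases Nat.eq_zero_or_pos M with rfl | hM
    · simp
    · simp [hM]
  rw [Finset.sum_sub_distrib, h3, Finset.sum_sub_distrib, ← Finset.mul_sum, ← Finset.mul_sum] at h2
  rw [Finset.sum_sub_distrib, ← Finset.mul_sum, ← Finset.mul_sum] at h1
  rw [h0, polyW_eval, polyW_eval]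
  simp only [Finset.sum_range_add, Finset.sum_add_distrib]
  have c1 : ∑ i ∈ Finset.range m, ∑ j ∈ Finset.range m,
      ((2 * coeffF m i j * wExt w ((i : ℤ) + j + 1 - m) : ℝ) : ℂ) * x ^ i * y ^ j * (x - y)
      = 2 * ∑ i ∈ Finset.range m, ∑ j ∈ Finset.range m,
        ((wExt w (((i + 1 : ℕ) : ℤ) + j - m) : ℂ) * x ^ (i + 1) * y ^ j
          - (wExt w ((i : ℤ) + (j + 1 : ℕ) - m) : ℂ) * x ^ i * y ^ (j + 1)) := by
    simp only [Finset.mul_sum]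
    refine Finset.sum_congr rfl fun i hi => Finset.sum_congr rfl fun j hj => ?_
    rw [Finset.mem_range] at hi hj
    rw [coeffF, if_pos ⟨hi, hj⟩, show ((i + 1 : ℕ) : ℤ) + j - m = (i : ℤ) + j + 1 - m by
      push_cast; ring, show (i : ℤ) + (j + 1 : ℕ) - m = (i : ℤ) + j + 1 - m by push_cast; ring]
    push_cast
    ring
  have c2 : ∑ i ∈ Finset.range M, ∑ j ∈ Finset.range M,
      ((2 * coeffF m (m + i) (m + j) * wExt w (((m + i : ℕ) : ℤ) + (m + j : ℕ) + 1 - m) : ℝ) : ℂ)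
        * x ^ (m + i) * y ^ (m + j) * (x - y)
      = -2 * ∑ i ∈ Finset.range M, ∑ j ∈ Finset.range M,
        ((wExt w ((m : ℤ) + (i + 1 : ℕ) + j) : ℂ) * x ^ (m + (i + 1)) * y ^ (m + j)
          - (wExt w ((m : ℤ) + i + (j + 1 : ℕ)) : ℂ) * x ^ (m + i) * y ^ (m + (j + 1))) := by
    simp only [Finset.mul_sum]
    refine Finset.sum_congr rfl fun i _ => Finset.sum_congr rfl fun j _ => ?_
    rw [coeffF, if_neg (by omega), if_pos (by omega),
      show ((m + i : ℕ) : ℤ) + (m + j : ℕ) + 1 - m = (m : ℤ) + i + j + 1 by push_cast; ring,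
      show (m : ℤ) + (i + 1 : ℕ) + j = (m : ℤ) + i + j + 1 by push_cast; ring,
      show (m : ℤ) + i + (j + 1 : ℕ) = (m : ℤ) + i + j + 1 by push_cast; ring]
    push_cast
    ring
  have z1 : ∑ i ∈ Finset.range m, ∑ j ∈ Finset.range M,
      ((2 * coeffF m i (m + j) * wExt w ((i : ℤ) + (m + j : ℕ) + 1 - m) : ℝ) : ℂ)
        * x ^ i * y ^ (m + j) = 0 := by
    refine Finset.sum_eq_zero fun i hi => Finset.sum_eq_zero fun j _ => ?_
    rw [Finset.mem_range] at hi
    rw [coeffF, if_neg (by omega), if_neg (by omega)]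
    simp
  have z2 : ∑ i ∈ Finset.range M, ∑ j ∈ Finset.range m,
      ((2 * coeffF m (m + i) j * wExt w (((m + i : ℕ) : ℤ) + j + 1 - m) : ℝ) : ℂ)
        * x ^ (m + i) * y ^ j = 0 := by
    refine Finset.sum_eq_zero fun i _ => Finset.sum_eq_zero fun j hj => ?_
    rw [Finset.mem_range] at hj
    rw [coeffF, if_neg (by omega), if_neg (by omega)]
    simp
  rw [z1, z2]
  simp only [← Finset.sum_mul] at c1 c2
  rw [h1] at c1
  rw [h2] at c2
  linear_combination c1 + c2

end Poly

/-! ### Contraction with the eigencovectors at the roots of W -/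

section Root

open Polynomial

variable {r : ℕ}

/-- The vector `g_m ζ`, for the covector `ζ_j = z^j`. -/
noncomputable def sharpPow (m : ℕ) (w : Fin r → ℝ) (z : ℂ) (i : Fin r) : ℂ :=
  ∑ j : Fin r, (metricP r m w i j : ℂ) * z ^ (j : ℕ)

theorem metricP_symm (m : ℕ) (w : Fin r → ℝ) (i j : Fin r) :
    metricP r m w i j = metricP r m w j i := by
  simp only [metricP, Matrix.of_apply, coeffF, and_comm, add_comm (i : ℤ)]

theorem X_sub_C_mul_sharpPow {m : ℕ} (hm : m ≤ r) (w : Fin r → ℝ) (z : ℂ) :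
    (X - C z) * polyV (sharpPow m w z)
      = C 2 * (X ^ m * C ((polyW w).eval z) - C (z ^ m) * polyW w) := by
  refine Polynomial.funext fun x => ?_
  simp only [eval_mul, eval_sub, eval_X, eval_C, eval_pow]
  rw [← metricP_generating hm, polyV_eval]
  simp only [sharpPow, Finset.sum_mul]
  congr 1
  exact Finset.sum_congr rfl fun i _ => Finset.sum_congr rfl fun j _ => by ring

theorem eval_of_X_sub_C_mul {P Q : ℂ[X]} {z : ℂ} (h : (X - C z) * P = Q) :
    P.eval z = (derivative Q).eval z := by
  rw [← h]
  simp

theorem eval_derivative_of_X_sub_C_mul {P Q : ℂ[X]} {z : ℂ} (h : (X - C z) * P = Q) :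
    2 * (derivative P).eval z = (derivative (derivative Q)).eval z := by
  rw [← h]
  simp
  ring

theorem mul_eval_derivative_X_pow (m : ℕ) (z : ℂ) :
    z * (derivative (X ^ m : ℂ[X])).eval z = m * z ^ m := by
  rcases m with _ | m
  · simp
  · rw [derivative_X_pow]
    simp [pow_succ]
    ring

variable {w : Fin r → ℝ} {z : ℂ}

/-- At a root, g_m ζ has generating polynomial -2 z^m W / (λ - z); its value and derivative at z
come from W' and W''. -/
theorem sharpPow_eval {m : ℕ} (hm : m ≤ r) (hz : (polyW w).eval z = 0) :
    (polyV (sharpPow m w z)).eval z = -2 * z ^ m * (derivative (polyW w)).eval z := by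
  rw [eval_of_X_sub_C_mul (X_sub_C_mul_sharpPow hm w z), hz]
  simp only [map_zero, mul_zero, zero_sub, mul_neg, derivative_neg, derivative_C_mul, eval_neg, eval_mul,
    eval_C]
  ring

theorem sharpPow_eval_derivative {m : ℕ} (hm : m ≤ r) (hz : (polyW w).eval z = 0) :
    (derivative (polyV (sharpPow m w z))).eval z
      = -z ^ m * (derivative (derivative (polyW w))).eval z := by
  have := eval_derivative_of_X_sub_C_mul (X_sub_C_mul_sharpPow hm w z)
  rw [hz] at this
  simp only [map_zero, mul_zero, zero_sub, mul_neg, derivative_neg, derivative_C_mul, eval_neg, eval_mul,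
    eval_C] at this
  linear_combination this / 2

/-- Both vectors are multiples of the coefficient vector of W / (λ - z), with factors -2 z^k and -2
z^l. -/
theorem sharpPow_proportional {k l : ℕ} (hk : k ≤ r) (hl : l ≤ r) (hz : (polyW w).eval z = 0)
    (i : Fin r) : z ^ k * sharpPow l w z i = z ^ l * sharpPow k w z i := by
  have h1 := X_sub_C_mul_sharpPow hk w z
  have h2 := X_sub_C_mul_sharpPow hl w z
  rw [hz] at h1 h2
  have e : (X - C z) * (C (z ^ k) * polyV (sharpPow l w z))
      = (X - C z) * (C (z ^ l) * polyV (sharpPow k w z)) := by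
    simp only [map_zero, mul_zero, zero_sub] at h1 h2
    linear_combination C (z ^ k) * h2 - C (z ^ l) * h1
  have e' := congrArg (fun p => p.coeff (i : ℕ)) (mul_left_cancel₀ (X_sub_C_ne_zero z) e)
  simpa only [coeff_C_mul, polyV_coeff] using e'

/-- The generating function is affine in W, so the increment replaces W by the polynomial of u; the
contraction is its limit on the diagonal x = y = z. The factor z avoids the exponent m - 1. -/
theorem metricP_variation {m : ℕ} (hm : m ≤ r) (u : Fin r → ℝ) :
    z * ∑ i : Fin r, ∑ j : Fin r,
        ((metricP r m (w + u) i j - metricP r m w i j : ℝ) : ℂ) * z ^ (i : ℕ) * z ^ (j : ℕ)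
      = 2 * z ^ m * (m * (polyV fun i => ((u i : ℝ) : ℂ)).eval z
        - z * (derivative (polyV fun i => ((u i : ℝ) : ℂ))).eval z) := by
  set E := polyV fun i => ((u i : ℝ) : ℂ)
  have h1 := X_sub_C_mul_sharpPow hm (w + u) z
  have h2 := X_sub_C_mul_sharpPow hm w z
  rw [polyW_add] at h1
  have h : (X - C z) * (polyV (sharpPow m (w + u) z) - polyV (sharpPow m w z))
      = C 2 * (X ^ m * C (E.eval z) - C (z ^ m) * E) := by
    rw [mul_sub, h1, h2]
    simp only [eval_add, C_add]
    ring
  have e := eval_of_X_sub_C_mul h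
  rw [eval_sub, polyV_eval, polyV_eval] at e
  have hs : ∑ i : Fin r, ∑ j : Fin r,
      ((metricP r m (w + u) i j - metricP r m w i j : ℝ) : ℂ) * z ^ (i : ℕ) * z ^ (j : ℕ)
      = ∑ i, sharpPow m (w + u) z i * z ^ (i : ℕ) - ∑ i, sharpPow m w z i * z ^ (i : ℕ) := by
    rw [← Finset.sum_sub_distrib]
    refine Finset.sum_congr rfl fun i _ => ?_
    simp only [sharpPow, Finset.sum_mul]
    rw [← Finset.sum_sub_distrib]
    refine Finset.sum_congr rfl fun j _ => ?_
    push_cast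
    ring
  rw [hs, e]
  have hx := mul_eval_derivative_X_pow m z
  simp only [derivative_mul, derivative_sub, derivative_C, eval_mul, eval_sub, eval_C,
    zero_mul, mul_zero, zero_add, add_zero]
  linear_combination 2 * E.eval z * hx

/-- The derivative of `∑ e^i z^i` along `g_m ζ`. -/
noncomputable def sharpDeriv (m : ℕ) (w : Fin r → ℝ) (D : Matrix (Fin r) (Fin r) ℝ) (z : ℂ) : ℂ :=
  ∑ p, sharpPow m w z p * ∑ i : Fin r, (D i p : ℂ) * z ^ (i : ℕ)

theorem contract_lie (m : ℕ) (D : Matrix (Fin r) (Fin r) ℝ) (u : Fin r → ℝ) :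
    ∑ i : Fin r, ∑ j : Fin r, (((metricP r m (w + u) - metricP r m w - D * metricP r m w
        - metricP r m w * D.transpose) i j : ℝ) : ℂ) * z ^ (i : ℕ) * z ^ (j : ℕ)
      = (∑ i : Fin r, ∑ j : Fin r,
        ((metricP r m (w + u) i j - metricP r m w i j : ℝ) : ℂ) * z ^ (i : ℕ) * z ^ (j : ℕ))
        - 2 * sharpDeriv m w D z := by
  have hD : ∑ i : Fin r, ∑ j : Fin r,
      (((D * metricP r m w) i j : ℝ) : ℂ) * z ^ (i : ℕ) * z ^ (j : ℕ) = sharpDeriv m w D z := by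
    simp only [sharpDeriv, sharpPow, Matrix.mul_apply, Complex.ofReal_sum, Finset.sum_mul,
      Finset.mul_sum, Complex.ofReal_mul]
    rw [Finset.sum_comm]
    refine (Finset.sum_congr rfl fun j _ => Finset.sum_comm).trans ?_
    rw [Finset.sum_comm]
    refine Finset.sum_congr rfl fun p _ => ?_
    rw [Finset.sum_comm]
    exact Finset.sum_congr rfl fun i _ => Finset.sum_congr rfl fun j _ => by ring
  have hDt : ∑ i : Fin r, ∑ j : Fin r,
      (((metricP r m w * D.transpose) i j : ℝ) : ℂ) * z ^ (i : ℕ) * z ^ (j : ℕ)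
      = sharpDeriv m w D z := by
    rw [← hD, Finset.sum_comm]
    refine Finset.sum_congr rfl fun i _ => Finset.sum_congr rfl fun j _ => ?_
    have : (metricP r m w * D.transpose) j i = (D * metricP r m w) i j := by
      simp only [Matrix.mul_apply, Matrix.transpose_apply]
      exact Finset.sum_congr rfl fun p _ => by rw [metricP_symm m w j p, mul_comm]
    rw [this]
    ring
  simp only [Matrix.sub_apply, Complex.ofReal_sub, sub_mul, Finset.sum_sub_distrib]
  rw [hD, hDt]
  ring

/-- The first relation is free of derivatives of e, as these enter the two contracted Lie equations
through proportional directions and cancel. The second is the contracted equation for g_k itself. -/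
theorem root_relations {k l : ℕ} (hk : k ≤ r) (hl : l ≤ r) (hz : (polyW w).eval z = 0)
    (hz0 : z ≠ 0) {D : Matrix (Fin r) (Fin r) ℝ} {u : Fin r → ℝ} {q : ℝ}
    (h1 : metricP r k (w + u) - metricP r k w - D * metricP r k w
      - metricP r k w * D.transpose = 0)
    (h2 : metricP r l (w + u) - metricP r l w - D * metricP r l w
      - metricP r l w * D.transpose = q • metricP r k w) :
    ((l : ℂ) - k) * z ^ l * (polyV fun i => ((u i : ℝ) : ℂ)).eval z
        + q * z ^ (k + 1) * (derivative (polyW w)).eval z = 0 ∧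
    z * sharpDeriv k w D z = z ^ k * (k * (polyV fun i => ((u i : ℝ) : ℂ)).eval z
        - z * (derivative (polyV fun i => ((u i : ℝ) : ℂ))).eval z) := by
  have v1 := metricP_variation (w := w) (z := z) hk u
  have v2 := metricP_variation (w := w) (z := z) hl u
  have c1 := contract_lie (w := w) (z := z) k D u
  have c2 := contract_lie (w := w) (z := z) l D u
  rw [h1] at c1
  rw [h2] at c2
  set E := polyV fun i => ((u i : ℝ) : ℂ)
  have g : ∑ i : Fin r, ∑ j : Fin r, (((q • metricP r k w) i j : ℝ) : ℂ) * z ^ (i : ℕ) * z ^ (j : ℕ)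
      = q * (-2 * z ^ k * (derivative (polyW w)).eval z) := by
    rw [← sharpPow_eval hk hz, polyV_eval, Finset.mul_sum]
    refine Finset.sum_congr rfl fun i _ => ?_
    simp only [sharpPow, Finset.sum_mul, Finset.mul_sum]
    refine Finset.sum_congr rfl fun j _ => ?_
    simp only [Matrix.smul_apply, smul_eq_mul, Complex.ofReal_mul]
    ring
  rw [g] at c2
  simp only [Matrix.zero_apply, Complex.ofReal_zero, zero_mul, Finset.sum_const_zero] at c1
  -- Eigencovector property: differentiating along g_l ζ or along g_k ζ is the same up to powers of
  -- z.
  have t : z ^ k * sharpDeriv l w D z = z ^ l * sharpDeriv k w D z := by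
    simp only [sharpDeriv, Finset.mul_sum (Finset.univ (α := Fin r)) _ (z ^ _), ← mul_assoc,
      sharpPow_proportional hk hl hz]
  refine ⟨?_, ?_⟩
  · refine mul_left_cancel₀ (mul_ne_zero two_ne_zero (pow_ne_zero k hz0)) ?_
    linear_combination z ^ l * v1 - z ^ k * v2 - z ^ (k + 1) * c2 + z ^ (l + 1) * c1
      + 2 * z * t
  · linear_combination v1 / 2 + z / 2 * c1

end Root

/-! ### Continuity of polynomial division by a monic divisor -/

section Division

open Polynomial

theorem natDegree_le_pred_of_coeff_eq_zero {p : ℂ[X]} {n : ℕ} (h : p.natDegree ≤ n + 1)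
    (hc : p.coeff (n + 1) = 0) : p.natDegree ≤ n := by
  rw [natDegree_le_iff_coeff_eq_zero]
  intro i hi
  rcases (Nat.succ_le_of_lt hi).eq_or_lt with rfl | h'
  · exact hc
  · exact coeff_eq_zero_of_natDegree_lt (h.trans_lt h')

/-- The quotient by a monic polynomial depends continuously on the coefficients. -/
theorem continuousAt_eval_divByMonic {T : Type*} [TopologicalSpace T] {t₀ : T} {n : ℕ}
    {W : T → ℂ[X]} (hW : ∀ t, (W t).Monic) (hWn : ∀ t, (W t).natDegree = n)
    (hWc : ∀ i, ContinuousAt (fun t => (W t).coeff i) t₀) (z : ℂ) (d : ℕ) :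
    ∀ N : T → ℂ[X], (∀ t, (N t).natDegree ≤ d) →
      (∀ i, ContinuousAt (fun t => (N t).coeff i) t₀) →
      ContinuousAt (fun t => (N t /ₘ W t).eval z) t₀ := by
  have small : ∀ N : T → ℂ[X], (∀ t, (N t).degree < (W t).degree) →
      ContinuousAt (fun t => (N t /ₘ W t).eval z) t₀ := by
    intro N hN
    have : ∀ t, N t /ₘ W t = 0 := fun t => (divByMonic_eq_zero_iff (hW t)).mpr (hN t)
    simp only [this, eval_zero]
    exact continuousAt_const
  have hdeg : ∀ t, (W t).degree = n := fun t => by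
    rw [degree_eq_natDegree (hW t).ne_zero, hWn]
  -- One step of long division: a multiple of W cancels the coefficient of degree d and preserves
  -- continuity of the coefficients.
  have step : ∀ (d : ℕ) (N : T → ℂ[X]), n ≤ d →
      (∀ i, ContinuousAt (fun t => (N t).coeff i) t₀) →
      (∀ i, ContinuousAt
        (fun t => (N t - C ((N t).coeff d) * X ^ (d - n) * W t).coeff i) t₀) ∧
      (∀ t, (N t - C ((N t).coeff d) * X ^ (d - n) * W t).coeff d = 0) ∧
      (∀ t, (N t).natDegree ≤ d →
        (N t - C ((N t).coeff d) * X ^ (d - n) * W t).natDegree ≤ d) ∧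
      ∀ t, N t /ₘ W t = C ((N t).coeff d) * X ^ (d - n)
        + (N t - C ((N t).coeff d) * X ^ (d - n) * W t) /ₘ W t := by
    intro d N hnd hNc
    refine ⟨fun i => ?_, fun t => ?_, fun t ht => ?_, fun t => ?_⟩
    · simp only [coeff_sub, mul_assoc, coeff_C_mul, coeff_X_pow_mul']
      refine (hNc i).sub ((hNc d).mul ?_)
      split_ifs
      · exact hWc _
      · exact continuousAt_const
    · have hc : (W t).coeff n = 1 := by
        have := (hW t).coeff_natDegree
        rwa [hWn] at this
      rw [coeff_sub, mul_assoc, coeff_C_mul, coeff_X_pow_mul', if_pos (Nat.sub_le _ _),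
        Nat.sub_sub_self hnd, hc, mul_one, sub_self]
    · refine (natDegree_sub_le _ _).trans (max_le ht ?_)
      refine natDegree_mul_le.trans ?_
      have := natDegree_C_mul_X_pow_le ((N t).coeff d) (d - n)
      rw [hWn]
      omega
    · refine (div_modByMonic_unique _ ((N t - C ((N t).coeff d) * X ^ (d - n) * W t) %ₘ W t)
        (hW t) ⟨?_, degree_modByMonic_lt _ (hW t)⟩).1
      linear_combination modByMonic_add_div (N t - C ((N t).coeff d) * X ^ (d - n) * W t) (W t)
  have finish : ∀ (d : ℕ) (N : T → ℂ[X]), n ≤ d →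
      (∀ i, ContinuousAt (fun t => (N t).coeff i) t₀) →
      ContinuousAt (fun t => ((N t - C ((N t).coeff d) * X ^ (d - n) * W t) /ₘ W t).eval z) t₀ →
      ContinuousAt (fun t => (N t /ₘ W t).eval z) t₀ := by
    intro d N hnd hNc h
    have e := (step d N hnd hNc).2.2.2
    simp only [e, eval_add, eval_mul, eval_C, eval_pow, eval_X]
    exact ((hNc d).mul continuousAt_const).add h
  induction d with
  | zero =>
    intro N hN hNc
    rcases Nat.eq_zero_or_pos n with hn | hn
    · refine finish 0 N hn.le hNc (small _ fun t => ?_)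
      obtain ⟨-, h0, hd, -⟩ := step 0 N hn.le hNc
      rw [eq_C_of_natDegree_le_zero (hd t (hN t)), h0, C_0, degree_zero]
      exact bot_lt_iff_ne_bot.mpr (degree_ne_bot.mpr (hW t).ne_zero)
    · refine small N fun t => ?_
      rw [hdeg]
      exact (natDegree_le_iff_degree_le.mp (hN t)).trans_lt (by exact_mod_cast hn)
  | succ d ih =>
    intro N hN hNc
    rcases le_or_gt n (d + 1) with hn | hn
    · obtain ⟨hc, h0, hd, -⟩ := step (d + 1) N hn hNc
      exact finish (d + 1) N hn hNc
        (ih _ (fun t => natDegree_le_pred_of_coeff_eq_zero (hd t (hN t)) (h0 t)) hc)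
    · refine small N fun t => ?_
      rw [hdeg]
      exact (natDegree_le_iff_degree_le.mp (hN t)).trans_lt (by exact_mod_cast hn)

/-- At a zero of the first factor the product rule needs only continuity of the second, so the
quotient A need not be shown differentiable in w. -/
theorem hasDerivAt_id_mul {h : ℝ → ℂ} (hc : ContinuousAt h 0) :
    HasDerivAt (fun t : ℝ => (t : ℂ) * h t) (h 0) 0 := by
  rw [hasDerivAt_iff_tendsto_slope]
  refine (hc.tendsto.mono_left nhdsWithin_le_nhds).congr' ?_
  filter_upwards [self_mem_nhdsWithin] with t ht
  have ht : t ≠ 0 := ht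
  have htc : (t : ℂ) ≠ 0 := by exact_mod_cast ht
  rw [slope_def_module]
  simp [ht]

end Division

/-! ### A necessary condition on `(k, l)` -/

section Obstruction

open Polynomial

variable {r : ℕ} {U : Set (Fin r → ℝ)} {e : (Fin r → ℝ) → Fin r → ℝ} {k l a b : ℕ} {q : ℝ}

/-- `∑ e^i λ^i`. -/
noncomputable abbrev polyField (e : (Fin r → ℝ) → Fin r → ℝ) (w : Fin r → ℝ) : ℂ[X] :=
  polyV fun i => ((e w i : ℝ) : ℂ)

/-- The polynomial `n λ^a ∑ e^i λ^i + q λ^b W'(λ)`. -/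
noncomputable def polyN (n : ℂ) (q : ℝ) (a b : ℕ) (e : (Fin r → ℝ) → Fin r → ℝ)
    (w : Fin r → ℝ) : ℂ[X] :=
  C n * X ^ a * polyField e w + C (q : ℂ) * X ^ b * derivative (polyW w)

theorem polyW_dvd_of_roots {w : Fin r → ℝ} (hw : (polyW w).roots.Nodup) {N : ℂ[X]}
    (h : ∀ z, (polyW w).eval z = 0 → N.eval z = 0) : polyW w ∣ N := by
  rcases eq_or_ne N 0 with rfl | hN
  · exact dvd_zero _
  have hW0 := (polyW_monic w).ne_zero
  rw [IsAlgClosed.dvd_iff_roots_le_roots hW0 hN, Multiset.le_iff_subset hw]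
  intro z hz
  rw [mem_roots hN]
  exact h z ((mem_roots hW0).mp hz)

theorem eval_derivative_polyW_ne_zero {w : Fin r → ℝ} (hw : (polyW w).roots.Nodup) {z : ℂ}
    (hz : (polyW w).eval z = 0) : (derivative (polyW w)).eval z ≠ 0 := by
  have hW0 := (polyW_monic w).ne_zero
  intro h
  have h1 : 1 < (polyW w).rootMultiplicity z :=
    (one_lt_rootMultiplicity_iff_isRoot hW0).mpr ⟨hz, h⟩
  rw [← count_roots] at h1
  exact absurd (Multiset.nodup_iff_count_le_one.mp hw z) (not_le.mpr h1)

theorem polyW_line (w u : Fin r → ℝ) (t : ℝ) :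
    polyW (w + t • u) = polyW w + C (t : ℂ) * polyV fun i => ((u i : ℝ) : ℂ) := by
  rw [polyW_add]
  congr 1
  simp only [polyV, Finset.mul_sum, Pi.smul_apply, smul_eq_mul, Complex.ofReal_mul, C_mul,
    mul_assoc]

theorem polyV_single (p : Fin r) :
    (polyV fun i => (((Pi.single p 1 : Fin r → ℝ) i : ℝ) : ℂ)) = X ^ (p : ℕ) := by
  simp only [polyV, Pi.single_apply]
  rw [Finset.sum_eq_single p]
  · simp
  · intro i _ hi
    simp [hi]
  · simp

/-- A crude bound suffices: the division argument only needs one that is uniform in w. -/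
theorem polyN_natDegree_le (n : ℂ) (q : ℝ) (a b : ℕ) (e : (Fin r → ℝ) → Fin r → ℝ)
    (w : Fin r → ℝ) : (polyN n q a b e w).natDegree ≤ (a + r) + (b + r) := by
  have h1 : (polyField e w).natDegree ≤ r :=
    natDegree_le_iff_degree_le.mpr (polyV_degree_lt _).le
  have h2 := natDegree_derivative_le (polyW w)
  rw [polyW_natDegree] at h2
  have h3 := natDegree_C_mul_X_pow_le n a
  have h4 := natDegree_C_mul_X_pow_le (q : ℂ) b
  refine (natDegree_add_le _ _).trans (max_le ?_ ?_) <;> refine natDegree_mul_le.trans ?_ <;> omega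

/-- Differentiating `polyN = (polyN /ₘ polyW) * polyW` in `w` at a root of `polyW`. -/
theorem pd_polyN (hU : IsOpen U) (he : ∀ i, ContDiffOn ℝ ∞ (fun w => e w i) U) {n : ℂ}
    (hN : ∀ w ∈ U, polyW w ∣ polyN n q a b e w) {w : Fin r → ℝ} (hw : w ∈ U) {z : ℂ}
    (hz : (polyW w).eval z = 0) (p : Fin r) :
    n * z ^ a * ∑ i : Fin r, (gradField e w i p : ℂ) * z ^ (i : ℕ)
        + q * z ^ b * (derivative (X ^ (p : ℕ) : ℂ[X])).eval z
      = (polyN n q a b e w /ₘ polyW w).eval z * z ^ (p : ℕ) := by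
  have hd := fun i => differentiableAt_of_smooth hU (he i) hw
  have hl : ∀ i, HasDerivAt (fun t : ℝ => ((e (w + t • Pi.single p 1) i : ℝ) : ℂ))
      (gradField e w i p : ℂ) 0 := by
    intro i
    have := hasDerivAt_line (hd i) (Pi.single p 1)
    simp only [Pi.single_apply, ite_mul, one_mul, zero_mul, Finset.sum_ite_eq', Finset.mem_univ,
      if_true] at this
    exact this.ofReal_comp
  have hlc : ∀ i, ContinuousAt (fun t : ℝ => ((e (w + t • Pi.single p 1) i : ℝ) : ℂ)) 0 :=
    fun i => (hl i).continuousAt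
  have htc : ContinuousAt (fun t : ℝ => (t : ℂ)) 0 := Complex.continuous_ofReal.continuousAt
  have hW : ∀ t : ℝ, polyW (w + t • Pi.single p 1) = polyW w + C (t : ℂ) * X ^ (p : ℕ) :=
    fun t => by rw [polyW_line, polyV_single]
  have hWc : ∀ i, ContinuousAt (fun t : ℝ => (polyW (w + t • Pi.single p 1)).coeff i) 0 := by
    intro i
    simp only [hW, coeff_add, coeff_C_mul]
    exact continuousAt_const.add (htc.mul continuousAt_const)
  have hNc : ∀ i, ContinuousAt
      (fun t : ℝ => (polyN n q a b e (w + t • Pi.single p 1)).coeff i) 0 := by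
    intro i
    have hE : ∀ i, ContinuousAt
        (fun t : ℝ => (polyField e (w + t • Pi.single p 1)).coeff i) 0 := by
      intro i
      simp only [polyField, polyV, finsetSum_coeff, coeff_C_mul]
      exact tendsto_finsetSum _ fun j _ => (hlc j).mul continuousAt_const
    simp only [polyN, coeff_add, mul_assoc, coeff_C_mul, coeff_X_pow_mul', coeff_derivative]
    refine ContinuousAt.add (continuousAt_const.mul ?_) (continuousAt_const.mul ?_)
    · split_ifs
      · exact hE _
      · exact continuousAt_const
    · split_ifs
      · exact (hWc _).mul continuousAt_const
      · exact continuousAt_const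
  have hA := continuousAt_eval_divByMonic (fun t : ℝ => polyW_monic (w + t • Pi.single p 1))
    (fun t => polyW_natDegree _) hWc z _ _ (fun t => polyN_natDegree_le n q a b e _) hNc
  have h1 := hasDerivAt_id_mul (hA.mul (continuousAt_const (y := z ^ (p : ℕ))))
  have h2 : HasDerivAt (fun t : ℝ => (polyN n q a b e (w + t • Pi.single p 1)).eval z)
      (n * z ^ a * ∑ i : Fin r, (gradField e w i p : ℂ) * z ^ (i : ℕ)
        + q * z ^ b * (derivative (X ^ (p : ℕ) : ℂ[X])).eval z) 0 := by
    simp only [polyN, hW, eval_add, eval_mul, eval_C, eval_pow, eval_X, polyField, polyV_eval,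
      derivative_add, derivative_C_mul]
    refine HasDerivAt.add (HasDerivAt.const_mul _ (HasDerivAt.fun_sum fun i _ =>
      (hl i).mul_const _)) (HasDerivAt.const_mul _ ?_)
    have := ((Complex.ofRealCLM.hasDerivAt (x := (0 : ℝ))).mul_const
      ((derivative (X ^ (p : ℕ) : ℂ[X])).eval z)).const_add ((derivative (polyW w)).eval z)
    simpa using this
  -- With z held fixed, the perturbed W takes the value t z^p at z, hence N takes the value t z^p
  -- A_t(z), whose derivative at t = 0 is z^p A(z).
  have h3 := h2.unique (h1.congr_of_eventuallyEq ((line_mem hU hw (Pi.single p 1)).mono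
    fun t ht => by
      have := modByMonic_add_div (polyN n q a b e (w + t • Pi.single p 1))
        (polyW (w + t • Pi.single p 1))
      rw [(modByMonic_eq_zero_iff_dvd (polyW_monic _)).mpr (hN _ ht), zero_add] at this
      have h4 := congrArg (eval z) this
      rw [eval_mul] at h4
      have h5 : (polyW (w + t • Pi.single p 1)).eval z = t * z ^ (p : ℕ) := by
        rw [hW]
        simp [hz]
      rw [h5] at h4
      simp only [Pi.mul_apply]
      rw [← h4]
      ring))
  rw [h3]
  simp

/-- The condition a + k + 1 = b + l makes N a power of z times the first relation of
`root_relations`, up to nonzero factors. For the second claim the w-derivatives of N = A W are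
summed against g_k ζ and compared with the λ-derivative of the same identity at z; the W'' terms
cancel, and N(z) = 0 eliminates E(z). -/
theorem quotient_at_root (hU : IsOpen U) (he : ∀ i, ContDiffOn ℝ ∞ (fun w => e w i) U)
    (hk : k ≤ r) (hl : l ≤ r) (hab : a + k + 1 = b + l)
    (hroots : ∀ w ∈ U, (polyW w).roots.Nodup)
    (hzero : ∀ w ∈ U, ∀ z, (polyW w).eval z = 0 → z ≠ 0)
    (h1 : ∀ w ∈ U, lieMetric k e w = 0)
    (h2 : ∀ w ∈ U, lieMetric l e w = q • metricP r k w) :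
    (∀ w ∈ U, polyW w ∣ polyN ((l : ℂ) - k) q a b e w) ∧
    ∀ w ∈ U, ∀ z, (polyW w).eval z = 0 →
      z * (polyN ((l : ℂ) - k) q a b e w /ₘ polyW w).eval z = q * ((l : ℂ) - 1) * z ^ b := by
  have hN : ∀ w ∈ U, polyW w ∣ polyN ((l : ℂ) - k) q a b e w := by
    refine fun w hw => polyW_dvd_of_roots (hroots w hw) fun z hz => ?_
    have hz0 := hzero w hw z hz
    have := (root_relations hk hl hz hz0 (h1 w hw) (h2 w hw)).1
    refine mul_left_cancel₀ (pow_ne_zero (k + 1 + l) hz0) ?_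
    simp only [polyN, eval_add, eval_mul, eval_C, eval_pow, eval_X]
    have ha : z ^ (k + 1 + l) * z ^ a = z ^ (b + l) * z ^ l := by
      rw [← pow_add, ← pow_add]
      congr 1
      omega
    linear_combination z ^ (b + l) * this
      + ((l : ℂ) - k) * (polyV fun i => ((e w i : ℝ) : ℂ)).eval z * ha
  refine ⟨hN, fun w hw z hz => ?_⟩
  have hz0 := hzero w hw z hz
  have hW' := eval_derivative_polyW_ne_zero (hroots w hw) hz
  have hT := (root_relations hk hl hz hz0 (h1 w hw) (h2 w hw)).2
  have hp := fun p => pd_polyN hU he hN hw hz p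
  -- The partial derivatives in w^p, weighted by the components of g_k ζ.
  have hs : ((l : ℂ) - k) * z ^ a * sharpDeriv k w (gradField e w) z
      + q * z ^ b * (derivative (polyV (sharpPow k w z))).eval z
      = (polyN ((l : ℂ) - k) q a b e w /ₘ polyW w).eval z * (polyV (sharpPow k w z)).eval z := by
    have hder : (derivative (polyV (sharpPow k w z))).eval z
        = ∑ p : Fin r, sharpPow k w z p * (derivative (X ^ (p : ℕ) : ℂ[X])).eval z := by
      simp only [polyV, derivative_sum, derivative_C_mul, eval_finsetSum, eval_mul, eval_C]
    rw [hder, polyV_eval, sharpDeriv, Finset.mul_sum, Finset.mul_sum, Finset.mul_sum,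
      ← Finset.sum_add_distrib]
    refine Finset.sum_congr rfl fun p _ => ?_
    linear_combination sharpPow k w z p * hp p
  rw [sharpPow_eval hk hz, sharpPow_eval_derivative hk hz] at hs
  have hfac := modByMonic_add_div (polyN ((l : ℂ) - k) q a b e w) (polyW w)
  rw [(modByMonic_eq_zero_iff_dvd (polyW_monic _)).mpr (hN _ hw), zero_add] at hfac
  set A := polyN ((l : ℂ) - k) q a b e w /ₘ polyW w
  have hNz := congrArg (eval z) hfac
  have hNz' := congrArg (fun P => eval z (derivative P)) hfac
  simp only [polyN, eval_add, eval_mul, eval_C, eval_pow, eval_X, hz, zero_mul] at hNz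
  simp only [polyN, derivative_add, derivative_mul, derivative_C, eval_add, eval_mul, eval_C,
    eval_pow, eval_X, hz, zero_mul, zero_add, add_zero] at hNz'
  have ma := mul_eval_derivative_X_pow a z
  have mb := mul_eval_derivative_X_pow b z
  have hab' : (a : ℂ) + k + 1 = b + l := by exact_mod_cast hab
  refine mul_left_cancel₀ (mul_ne_zero (pow_ne_zero k hz0) hW') ?_
  have hT' : z * sharpDeriv k w (gradField e w) z
      = z ^ k * (k * (polyField e w).eval z - z * (derivative (polyField e w)).eval z) := hT
  linear_combination z * hs - z ^ (k + 1) * hNz' - ((l : ℂ) - k) * z ^ a * hT'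
    - ((l : ℂ) - k) * z ^ k * (polyField e w).eval z * ma
    - q * z ^ k * (derivative (polyW w)).eval z * mb + (k + a) * z ^ k * hNz
    + q * z ^ k * z ^ b * (derivative (polyW w)).eval z * hab'

end Obstruction

/-! ### Degree counts that determine (k, l) -/

section Endgame

open Polynomial

variable {r : ℕ}

/-- For z = 0 the covector ζ is the first basis covector, and g_m ζ = 0 when m > 0, so g_m would
have a zero column. -/
theorem ne_zero_of_root [NeZero r] {m : ℕ} (hm0 : m ≠ 0) (hm : m ≤ r) {w : Fin r → ℝ}
    (hdet : (metricP r m w).det ≠ 0) {z : ℂ} (hz : (polyW w).eval z = 0) : z ≠ 0 := by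
  rintro rfl
  have h := X_sub_C_mul_sharpPow hm w 0
  rw [hz] at h
  simp only [map_zero, mul_zero, zero_pow hm0, zero_mul, sub_zero] at h
  have h0 : polyV (sharpPow m w 0) = 0 := (mul_eq_zero.mp h).resolve_left X_ne_zero
  refine hdet (Matrix.det_eq_zero_of_column_eq_zero (0 : Fin r) fun i => ?_)
  have h1 := polyV_coeff (sharpPow m w 0) i
  rw [h0, coeff_zero, sharpPow, Finset.sum_eq_single (0 : Fin r)] at h1
  · simpa using h1.symm
  · intro j _ hj
    have : (j : ℕ) ≠ 0 := fun h => hj (Fin.ext (by simpa using h))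
    simp [this]
  · simp

theorem IsAdmissible.root_ne_zero [NeZero r] {k l : ℕ} (hk : k ≤ r) (hl : l ≤ r) (hkl : k ≠ l)
    {U : Set (Fin r → ℝ)} (hU : IsAdmissible k l U) {w : Fin r → ℝ} (hw : w ∈ U) {z : ℂ}
    (hz : (polyW w).eval z = 0) : z ≠ 0 := by
  rcases Nat.eq_zero_or_pos k with rfl | hk0
  · exact ne_zero_of_root (Ne.symm hkl) hl (hU.det_right w hw) hz
  · exact ne_zero_of_root hk0.ne' hk (hU.det_left w hw) hz

theorem polyW_coeff_top (w : Fin r → ℝ) : (polyW w).coeff r = 1 := by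
  have := (polyW_monic w).coeff_natDegree
  rwa [polyW_natDegree] at this

theorem polyV_coeff_of_le (c : Fin r → ℂ) {i : ℕ} (hi : r ≤ i) : (polyV c).coeff i = 0 :=
  coeff_eq_zero_of_degree_lt ((polyV_degree_lt c).trans_le (by exact_mod_cast hi))

theorem ofReal_polyV_eq_zero {c : Fin r → ℝ} (h : (polyV fun i => ((c i : ℝ) : ℂ)) = 0) :
    c = 0 := by
  ext i
  have := polyV_coeff (fun i => ((c i : ℝ) : ℂ)) i
  rw [h, coeff_zero] at this
  exact_mod_cast this.symm

theorem eq_zero_of_polyW_dvd {w : Fin r → ℝ} {P : ℂ[X]} (h : polyW w ∣ P)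
    (hd : P.degree < r) : P = 0 :=
  eq_zero_of_dvd_of_degree_lt h (by rwa [polyW_degree])

/-- Write W = λ^r + V with d = deg V. The λ^{2r} terms cancel, and the coefficient of λ^{r+d}
receives nothing from E or V², both of lower degree. What remains forces d = 2r + 1, against d < r.
-/
theorem no_double_top {w : Fin r → ℝ} {V E : ℂ[X]} {n q : ℂ} (hq : q ≠ 0)
    (hV : polyW w = X ^ r + V) (hVd : V.degree < r) (hV0 : V ≠ 0) (hE : E.degree < r)
    (h : C n * E + C q * X ^ (r + 1) * derivative (polyW w)
      = polyW w * (C (q * (r + 1)) * polyW w - C q * X ^ r)) : False := by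
  have hX : X ^ (r + 1) * derivative (X ^ r : ℂ[X]) = C (r : ℂ) * (X ^ r * X ^ r) := by
    rcases r with _ | r
    · simp
    · rw [derivative_X_pow, Nat.add_sub_cancel]
      ring
  have hdr : V.natDegree < r := (natDegree_lt_iff_degree_lt hV0).mpr hVd
  have key : C n * E + C q * (X ^ r * (X * derivative V))
      = C (q * (2 * r + 1)) * (X ^ r * V) + C (q * (r + 1)) * V ^ 2 := by
    rw [hV, derivative_add] at h
    simp only [C_mul, C_add, C_ofNat, C_1] at h ⊢
    linear_combination h - C q * hX
  have hc := congrArg (fun P => P.coeff (V.natDegree + r)) key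
  have hxd : (X * derivative V).coeff V.natDegree = V.natDegree * V.coeff V.natDegree := by
    rcases V.natDegree with _ | d
    · simp
    · rw [coeff_X_mul, coeff_derivative]
      push_cast
      ring
  have hsq : (V ^ 2).coeff (V.natDegree + r) = 0 :=
    coeff_eq_zero_of_natDegree_lt (natDegree_pow_le.trans_lt (by omega))
  have hE0 : E.coeff (V.natDegree + r) = 0 :=
    coeff_eq_zero_of_degree_lt (hE.trans_le (by exact_mod_cast Nat.le_add_left _ _))
  simp only [coeff_add, coeff_C_mul, coeff_X_pow_mul, hxd, hsq, hE0] at hc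
  have hlead : V.coeff V.natDegree ≠ 0 := by simpa using hV0
  have hc' : (q * V.coeff V.natDegree) * ((V.natDegree : ℂ) - (2 * r + 1)) = 0 := by
    linear_combination hc
  have h2 := (mul_eq_zero.mp hc').resolve_left (mul_ne_zero hq hlead)
  have h3 : (V.natDegree : ℂ) = ((2 * r + 1 : ℕ) : ℂ) := by
    push_cast
    linear_combination h2
  have h4 : V.natDegree = 2 * r + 1 := by exact_mod_cast h3
  omega

theorem polyN_factor {e : (Fin r → ℝ) → Fin r → ℝ} {q : ℝ} {n : ℂ} {a b : ℕ} {w : Fin r → ℝ} (h : polyW w ∣ polyN n q a b e w) :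
    polyN n q a b e w = polyW w * (polyN n q a b e w /ₘ polyW w) := by
  have := modByMonic_add_div (polyN n q a b e w) (polyW w)
  rw [(modByMonic_eq_zero_iff_dvd (polyW_monic _)).mpr h, zero_add] at this
  exact this.symm

variable [NeZero r] {U : Set (Fin r → ℝ)} {e : (Fin r → ℝ) → Fin r → ℝ} {k l : ℕ} {q : ℝ}

/-- If q = 0 then E vanishes at r distinct roots while its degree is below r, so e = 0. -/
theorem scale_ne_zero (hk : k ≤ r) (hl : l ≤ r) (hkl : k ≠ l) (hU : IsAdmissible k l U)
    (h1 : ∀ w ∈ U, lieMetric k e w = 0)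
    (h2 : ∀ w ∈ U, lieMetric l e w = q • metricP r k w)
    (hne : ∀ w ∈ U, e w ≠ 0) : q ≠ 0 := by
  rintro rfl
  obtain ⟨w, hw⟩ := hU.nonempty
  refine hne w hw (ofReal_polyV_eq_zero (eq_zero_of_polyW_dvd (w := w) ?_ (polyV_degree_lt _)))
  refine polyW_dvd_of_roots (hU.roots_distinct w hw) fun z hz => ?_
  have hz0 := hU.root_ne_zero hk hl hkl hw hz
  have := (root_relations hk hl hz hz0 (h1 w hw) (h2 w hw)).1
  have hn : (l : ℂ) - k ≠ 0 := sub_ne_zero.mpr (by exact_mod_cast hkl.symm)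
  simp only [Complex.ofReal_zero, zero_mul, add_zero] at this
  exact (mul_eq_zero.mp this).resolve_left (mul_ne_zero hn (pow_ne_zero l hz0))

theorem eq_zero_one_of_lt (hlt : k < l) (hl : l ≤ r) (hU : IsAdmissible k l U)
    (he : ∀ i, ContDiffOn ℝ ∞ (fun w => e w i) U)
    (h1 : ∀ w ∈ U, lieMetric k e w = 0)
    (h2 : ∀ w ∈ U, lieMetric l e w = q • metricP r k w)
    (hq : q ≠ 0) : k = 0 ∧ l = 1 := by
  obtain ⟨a, rfl⟩ := Nat.exists_eq_add_of_lt hlt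
  have hk : k ≤ r := hlt.le.trans hl
  obtain ⟨hN, hA⟩ := quotient_at_root (a := a) (b := 0) hU.isOpen he hk hl (by omega)
    hU.roots_distinct (fun w hw z hz => hU.root_ne_zero hk hl hlt.ne hw hz) h1 h2
  obtain ⟨w, hw⟩ := hU.nonempty
  have hf := polyN_factor (hN w hw)
  specialize hA w hw
  set n : ℂ := ((k + a + 1 : ℕ) : ℂ) - k
  set A := polyN n q a 0 e w /ₘ polyW w
  have hNd : (polyN n q a 0 e w).degree < ((a + r : ℕ) : WithBot ℕ) := by
    rw [degree_lt_iff_coeff_zero]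
    intro m hm
    have hWm : (polyW w).coeff (m + 1) = 0 :=
      coeff_eq_zero_of_natDegree_lt (by rw [polyW_natDegree]; omega)
    simp only [polyN, coeff_add, mul_assoc, coeff_C_mul, coeff_X_pow_mul', coeff_derivative]
    rw [if_pos (by omega), if_pos (by omega), Nat.sub_zero, hWm, polyV_coeff_of_le _ (by omega)]
    ring
  have hAd : (X * A).natDegree ≤ a := by
    rcases eq_or_ne A 0 with h0 | h0
    · simp [h0]
    · have hN0 : polyN n q a 0 e w ≠ 0 := by
        rw [hf]
        exact mul_ne_zero (polyW_monic w).ne_zero h0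
      have := (natDegree_lt_iff_degree_lt hN0).mpr hNd
      rw [hf, natDegree_mul (polyW_monic w).ne_zero h0, polyW_natDegree] at this
      rw [natDegree_X_mul h0]
      omega
  -- The degree is at most a = l - k - 1 < r and all r roots of W are zeros. The value at λ = 0 then
  -- gives q (l - 1) = 0.
  have hP : X * A - C ((q : ℂ) * (((k + a + 1 : ℕ) : ℂ) - 1)) = 0 := by
    refine eq_zero_of_polyW_dvd (polyW_dvd_of_roots (hU.roots_distinct w hw) fun z hz => ?_) ?_
    · have := hA z hz
      simp only [eval_sub, eval_mul, eval_X, eval_C]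
      linear_combination this
    · refine (natDegree_le_iff_degree_le.mp ((natDegree_sub_le _ _).trans
        (max_le hAd ((natDegree_C _).le.trans (Nat.zero_le _))))).trans_lt ?_
      exact_mod_cast (by omega : a < r)
  have h0 := congrArg (eval 0) hP
  have hqc : (q : ℂ) ≠ 0 := by exact_mod_cast hq
  simp only [eval_sub, eval_mul, eval_X, eval_C, zero_mul, zero_sub, eval_zero, neg_eq_zero,
    mul_eq_zero, hqc, false_or, sub_eq_zero] at h0
  have : k + a + 1 = 1 := by exact_mod_cast h0
  omega

/-- Here b = k - l + 1. The leading coefficient q r of N conflicts with A = q (l - 1) λ^{k-l}, so A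
also contains a nonzero multiple of W. Degrees then force k = r and l = 0, the case of
`no_double_top`. -/
theorem not_lt_of_lie (hlt : l < k) (hk : k ≤ r) (hU : IsAdmissible k l U)
    (he : ∀ i, ContDiffOn ℝ ∞ (fun w => e w i) U)
    (h1 : ∀ w ∈ U, lieMetric k e w = 0)
    (h2 : ∀ w ∈ U, lieMetric l e w = q • metricP r k w)
    (hq : q ≠ 0) : False := by
  obtain ⟨s, hs⟩ := Nat.exists_eq_add_of_lt hlt
  have hl : l ≤ r := hlt.le.trans hk
  obtain ⟨hN, hA⟩ := quotient_at_root (a := 0) (b := s + 2) hU.isOpen he hk hl (by omega)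
    hU.roots_distinct (fun w hw z hz => hU.root_ne_zero hk hl hlt.ne' hw hz) h1 h2
  obtain ⟨w, hw⟩ := hU.nonempty
  have hf := polyN_factor (hN w hw)
  specialize hA w hw
  have hqc : (q : ℂ) ≠ 0 := by exact_mod_cast hq
  have hr : 1 ≤ r := NeZero.one_le
  set n : ℂ := (l : ℂ) - k
  set A := polyN n q 0 (s + 2) e w /ₘ polyW w
  have hW0 := (polyW_monic w).ne_zero
  have hNe : polyN n q 0 (s + 2) e w
      = C n * polyField e w + C (q : ℂ) * X ^ (s + 2) * derivative (polyW w) := by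
    rw [polyN, pow_zero, mul_one]
  have htop : (polyN n q 0 (s + 2) e w).coeff (s + 1 + r) = q * r := by
    obtain ⟨t, ht⟩ := Nat.exists_eq_add_of_le' hr
    rw [hNe, coeff_add, coeff_C_mul, polyV_coeff_of_le _ (by omega), mul_assoc, coeff_C_mul,
      show s + 1 + r = t + (s + 2) by omega, coeff_X_pow_mul, coeff_derivative, ← ht,
      polyW_coeff_top, ht]
    push_cast
    ring
  have hNd : (polyN n q 0 (s + 2) e w).natDegree ≤ s + 1 + r := by
    have h3 : (polyField e w).natDegree ≤ r :=
      natDegree_le_iff_degree_le.mpr (polyV_degree_lt _).le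
    have h4 := natDegree_derivative_le (polyW w)
    rw [polyW_natDegree] at h4
    have h5 := natDegree_C_mul_X_pow_le (q : ℂ) (s + 2)
    rw [hNe]
    refine (natDegree_add_le _ _).trans (max_le ?_ ?_)
    · exact (natDegree_C_mul_le _ _).trans (by omega)
    · exact natDegree_mul_le.trans (by omega)
  have hAd : A.natDegree ≤ s + 1 := by
    rcases eq_or_ne A 0 with h0 | h0
    · simp [h0]
    · rw [hf, natDegree_mul hW0 h0, polyW_natDegree] at hNd
      omega
  obtain ⟨S, hS⟩ : polyW w ∣ A - C ((q : ℂ) * ((l : ℂ) - 1)) * X ^ (s + 1) := by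
    refine polyW_dvd_of_roots (hU.roots_distinct w hw) fun z hz => ?_
    refine mul_left_cancel₀ (hU.root_ne_zero hk hl hlt.ne' hw hz) ?_
    simp only [eval_sub, eval_mul, eval_X, eval_C, eval_pow]
    linear_combination hA z hz
  have hA' : A = polyW w * S + C ((q : ℂ) * ((l : ℂ) - 1)) * X ^ (s + 1) := by
    linear_combination hS
  rcases eq_or_ne S 0 with h0 | h0
  · rw [hf, hA', h0, mul_zero, zero_add, mul_left_comm, coeff_C_mul, mul_comm (polyW w),
      add_comm (s + 1) r, coeff_X_pow_mul, polyW_coeff_top, mul_one] at htop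
    have h3 : (l : ℂ) = ((r + 1 : ℕ) : ℂ) := by
      push_cast
      linear_combination mul_left_cancel₀ hqc htop
    have : l = r + 1 := by exact_mod_cast h3
    omega
  · have hSd : (polyW w * S).natDegree ≤ s + 1 := by
      rw [← hS]
      exact (natDegree_sub_le _ _).trans (max_le hAd (natDegree_C_mul_X_pow_le _ _))
    rw [natDegree_mul hW0 h0, polyW_natDegree] at hSd
    have hsr : s + 1 = r := by omega
    have hl0 : l = 0 := by omega
    obtain ⟨σ, rfl⟩ : ∃ σ, S = C σ := ⟨_, eq_C_of_natDegree_eq_zero (by omega)⟩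
    rw [hsr, hl0] at hA'
    have hWW : (polyW w * polyW w).coeff (r + r) = 1 := by
      have := ((polyW_monic w).mul (polyW_monic w)).coeff_natDegree
      rwa [natDegree_mul hW0 hW0, polyW_natDegree] at this
    have hexp : polyN n q 0 (s + 2) e w
        = C σ * (polyW w * polyW w) - C (q : ℂ) * (X ^ r * polyW w) := by
      rw [hf, hA']
      simp only [Nat.cast_zero, zero_sub, mul_neg, mul_one, C_neg]
      ring
    rw [hexp, hsr, coeff_sub, coeff_C_mul, coeff_C_mul, hWW, coeff_X_pow_mul,
      polyW_coeff_top] at htop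
    have hσ : σ = q * (r + 1) := by linear_combination htop
    -- Otherwise W = λ^r has the root 0, which admissibility forbids.
    have hV0 : (polyV fun i => ((w i : ℝ) : ℂ)) ≠ 0 := by
      intro hV
      refine hU.root_ne_zero hk hl hlt.ne' hw (z := 0) ?_ rfl
      rw [polyW_eq, hV]
      simp [NeZero.ne r]
    refine no_double_top (n := n) (E := polyField e w) hqc (polyW_eq w) (polyV_degree_lt _) hV0
      (polyV_degree_lt _) ?_
    rw [← hσ, show r + 1 = s + 2 by omega, ← hNe, hexp]
    ring

end Endgame

/-! ### The pair (0, 1): closedness of the covector dual to the unit -/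

section Closed

open Polynomial

variable {r : ℕ}

theorem polyW_coeff_succ (w : Fin r → ℝ) (i : Fin r) :
    (polyW w).coeff (i + 1) = (wExt w ((i : ℤ) + 1) : ℂ) := by
  rcases (Nat.succ_le_of_lt i.2).eq_or_lt with h | h
  · have h' : (i : ℤ) + 1 = r := by exact_mod_cast h
    rw [h', wExt_top, show (i : ℕ) + 1 = r from h, polyW_coeff_top, Complex.ofReal_one]
  · have hi : (i : ℕ) + 1 < r := h
    rw [wExt, dif_pos ⟨by omega, by omega⟩, polyW_eq, coeff_add, coeff_X_pow, if_neg (by omega),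
      zero_add]
    exact polyV_coeff (fun i => ((w i : ℝ) : ℂ)) ⟨i + 1, hi⟩

/-- With a = b = 0 the polynomial N = E + q W' has degree below r, so divisibility by W forces E =
-q W'. -/
theorem unitField_zero_one [NeZero r] {U : Set (Fin r → ℝ)} {e : (Fin r → ℝ) → Fin r → ℝ} {q : ℝ}
    (hU : IsAdmissible 0 1 U) (he : ∀ i, ContDiffOn ℝ ∞ (fun w => e w i) U)
    (h1 : ∀ w ∈ U, lieMetric 0 e w = 0) (h2 : ∀ w ∈ U, lieMetric 1 e w = q • metricP r 0 w)
    {w : Fin r → ℝ} (hw : w ∈ U) (i : Fin r) :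
    e w i = -q * (((i : ℕ) : ℝ) + 1) * wExt w ((i : ℤ) + 1) := by
  have hN := (quotient_at_root (a := 0) (b := 0) hU.isOpen he (Nat.zero_le r) NeZero.one_le rfl
    hU.roots_distinct (fun w hw z hz => hU.root_ne_zero (Nat.zero_le r) NeZero.one_le
      zero_ne_one hw hz) h1 h2).1 w hw
  have h0 := eq_zero_of_polyW_dvd hN (by
    rw [degree_lt_iff_coeff_zero]
    intro m hm
    have hWm : (polyW w).coeff (m + 1) = 0 :=
      coeff_eq_zero_of_natDegree_lt (by rw [polyW_natDegree]; omega)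
    simp only [polyN, pow_zero, mul_one, coeff_add, coeff_C_mul, coeff_derivative]
    rw [hWm, polyV_coeff_of_le _ hm]
    ring)
  have hc := congrArg (fun P => P.coeff (i : ℕ)) h0
  simp only [polyN, pow_zero, mul_one, coeff_add, coeff_C_mul, coeff_derivative, polyV_coeff,
    polyW_coeff_succ, coeff_zero, Nat.cast_one, Nat.cast_zero, sub_zero, one_mul] at hc
  have hc' : ((e w i + q * (wExt w ((i : ℤ) + 1) * (((i : ℕ) : ℝ) + 1)) : ℝ) : ℂ) = 0 := by
    push_cast
    exact hc
  have := Complex.ofReal_eq_zero.mp hc'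
  linarith

theorem wExt_line_single {i : Fin r} (w : Fin r → ℝ) (t : ℝ) (n : ℤ) :
    wExt (w + t • Pi.single i 1) n = wExt w n + if n = i then t else 0 := by
  unfold wExt
  split_ifs with h1 h2 h2 h2
  · have : (⟨n.toNat, by omega⟩ : Fin r) = i := Fin.ext (by simp [h2])
    simp [this]
  · have : (⟨n.toNat, by omega⟩ : Fin r) ≠ i := fun h => h2 (by
      rw [← h]
      simp [h1.1])
    simp [this]
  all_goals first | omega | simp

theorem hasDerivAt_wExt_single (i : Fin r) (w : Fin r → ℝ) (n : ℤ) :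
    HasDerivAt (fun t : ℝ => wExt (w + t • Pi.single i 1) n) (if n = i then 1 else 0) 0 := by
  simp only [wExt_line_single]
  split_ifs
  · exact (hasDerivAt_id (0 : ℝ)).const_add _
  · exact hasDerivAt_const _ _

/-- The triangular recursion satisfied by the components of the covector dual to the unit. -/
theorem triangular_recursion {w : Fin r → ℝ} {q : ℝ} {θ : ℕ → ℝ}
    (h : ∀ i < r, ∑ j ∈ Finset.range r, -2 * wExt w ((i : ℤ) + j + 1) * θ j
      = -q * ((i : ℝ) + 1) * wExt w ((i : ℤ) + 1)) {j : ℕ} (hj : j < r) :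
    θ j = q / 2 * ((r : ℝ) - j) * wExt w ((r : ℤ) - j)
      - ∑ m ∈ Finset.range j, wExt w ((r : ℤ) - j + m) * θ m := by
  obtain ⟨i, hi⟩ : ∃ i, r = j + (i + 1) := Nat.exists_eq_add_of_lt hj
  have hr : (r : ℤ) = j + (i + 1) := by exact_mod_cast hi
  have hrr : (r : ℝ) = j + (i + 1) := by exact_mod_cast hi
  have h1 := h i (by omega)
  rw [show Finset.range r = Finset.range (j + 1 + i) by congr 1; omega, Finset.sum_range_add,
    Finset.sum_range_succ, Finset.sum_eq_zero (s := Finset.range i)] at h1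
  · have ht : wExt w ((i : ℤ) + j + 1) = 1 := by
      rw [← wExt_top w]
      congr 1
      omega
    rw [ht] at h1
    have h2 : ∑ m ∈ Finset.range j, -2 * wExt w ((i : ℤ) + m + 1) * θ m
        = -2 * ∑ m ∈ Finset.range j, wExt w ((r : ℤ) - j + m) * θ m := by
      rw [Finset.mul_sum]
      refine Finset.sum_congr rfl fun m _ => ?_
      rw [show (r : ℤ) - j + m = (i : ℤ) + m + 1 by omega]
      ring
    rw [h2] at h1
    rw [show (r : ℤ) - j = (i : ℤ) + 1 by omega] at *
    rw [show (r : ℝ) - j = (i : ℝ) + 1 by linarith]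
    linarith
  · intro m _
    rw [wExt_gt w (by push_cast; omega)]
    ring

/-- Let θ = dφ. The recursion gives θ_0 = q r / 2 and θ_1 = -(q / 2) w^{r-1}, while w^1 enters
θ_{r-1} with coefficient q / 2 - θ_0. For r ≥ 3 the symmetry ∂_1 θ_{r-1} = ∂_{r-1} θ_1 becomes q (r
- 2) = 0. -/
theorem le_two_of_closed [NeZero r] {U : Set (Fin r → ℝ)} (hU : IsOpen U) (hne : U.Nonempty)
    {q : ℝ} (hq : q ≠ 0) {φ : (Fin r → ℝ) → ℝ} (hφ : ContDiffOn ℝ ∞ φ U)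
    (h : ∀ w ∈ U, ∀ i : Fin r, ∑ j, metricP r 0 w i j * pd j φ w
      = -q * (((i : ℕ) : ℝ) + 1) * wExt w ((i : ℤ) + 1)) : r ≤ 2 := by
  by_contra! hr
  let θ : ℕ → (Fin r → ℝ) → ℝ := fun j => if hj : j < r then pd ⟨j, hj⟩ φ else 0
  have hθ : ∀ j (hj : j < r), θ j = pd ⟨j, hj⟩ φ := fun j hj => dif_pos hj
  have hrec : ∀ w ∈ U, ∀ j < r, θ j w = q / 2 * ((r : ℝ) - j) * wExt w ((r : ℤ) - j)
      - ∑ m ∈ Finset.range j, wExt w ((r : ℤ) - j + m) * θ m w := by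
    intro w hw j hj
    refine triangular_recursion (θ := fun j => θ j w) (fun i hi => ?_) hj
    rw [← h w hw ⟨i, hi⟩, ← Fin.sum_univ_eq_sum_range
      (fun j => -2 * wExt w ((i : ℤ) + j + 1) * θ j w)]
    refine Finset.sum_congr rfl fun j _ => ?_
    rw [hθ j j.2]
    simp [metricP, coeffF]
  have h0 : ∀ w ∈ U, θ 0 w = q / 2 * r := by
    intro w hw
    have := hrec w hw 0 (by omega)
    simpa [wExt_top] using this
  let i₁ : Fin r := ⟨1, by omega⟩
  let i₂ : Fin r := ⟨r - 1, by omega⟩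
  -- For j ≤ r - 2 every coordinate in the recursion has index at least r - j ≥ 2, so θ_j does not
  -- involve w^1.
  have hconst : ∀ j, j + 1 < r → ∀ w ∈ U,
      HasDerivAt (fun t : ℝ => θ j (w + t • Pi.single i₁ 1)) 0 0 := by
    intro j
    induction j using Nat.strong_induction_on with
    | _ j ih =>
      intro hj w hw
      have hd : HasDerivAt (fun t : ℝ => q / 2 * ((r : ℝ) - j)
          * wExt (w + t • Pi.single i₁ 1) ((r : ℤ) - j)
          - ∑ m ∈ Finset.range j, wExt (w + t • Pi.single i₁ 1) ((r : ℤ) - j + m)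
            * θ m (w + t • Pi.single i₁ 1)) 0 0 := by
        have e1 := (hasDerivAt_wExt_single i₁ w ((r : ℤ) - j)).const_mul (q / 2 * ((r : ℝ) - j))
        have e2 := HasDerivAt.fun_sum (u := Finset.range j) fun m hm =>
          (hasDerivAt_wExt_single i₁ w ((r : ℤ) - j + m)).fun_mul
            (ih m (Finset.mem_range.mp hm) (by have := Finset.mem_range.mp hm; omega) w hw)
        have e3 := e1.fun_sub e2
        rw [if_neg (by simp only [i₁]; omega), Finset.sum_eq_zero] at e3
        · simpa using e3
        · intro m _
          rw [if_neg (by simp only [i₁]; omega)]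
          ring
      exact hd.congr_of_eventuallyEq ((line_mem hU hw (Pi.single i₁ 1)).mono fun t ht =>
        hrec _ ht j (by omega))
  obtain ⟨w, hw⟩ := hne
  have hd1 : HasDerivAt (fun t : ℝ => θ (r - 1) (w + t • Pi.single i₁ 1))
      (q / 2 - q / 2 * r) 0 := by
    obtain ⟨s, hs⟩ : ∃ s, r - 1 = s + 1 := ⟨r - 2, by omega⟩
    have hsr : (r : ℝ) = s + 2 := by exact_mod_cast (by omega : r = s + 2)
    have hsz : (r : ℤ) = s + 2 := by exact_mod_cast (by omega : r = s + 2)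
    have hd : HasDerivAt (fun t : ℝ => q / 2 * ((r : ℝ) - (r - 1 : ℕ))
        * wExt (w + t • Pi.single i₁ 1) ((r : ℤ) - (r - 1 : ℕ))
        - ∑ m ∈ Finset.range (r - 1), wExt (w + t • Pi.single i₁ 1) ((r : ℤ) - (r - 1 : ℕ) + m)
          * θ m (w + t • Pi.single i₁ 1)) (q / 2 - q / 2 * r) 0 := by
      have e1 := (hasDerivAt_wExt_single i₁ w ((r : ℤ) - (r - 1 : ℕ))).const_mul
        (q / 2 * ((r : ℝ) - (r - 1 : ℕ)))
      have e2 := HasDerivAt.fun_sum (u := Finset.range (r - 1)) fun m hm =>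
        (hasDerivAt_wExt_single i₁ w ((r : ℤ) - (r - 1 : ℕ) + m)).fun_mul
          (hconst m (by have := Finset.mem_range.mp hm; omega) w hw)
      have e3 := e1.fun_sub e2
      refine e3.congr_deriv ?_
      -- The m = 0 summand w^1 θ_0 is split off, being the only one in which w^1 occurs.
      rw [if_pos (by simp only [i₁]; omega), hs, Finset.sum_range_succ', Finset.sum_eq_zero]
      · rw [if_pos (by simp only [i₁]; push_cast; omega)]
        simp only [zero_smul, add_zero, h0 w hw]
        push_cast
        rw [hsr]
        ring
      · intro m _
        rw [if_neg (by simp only [i₁]; push_cast; omega)]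
        ring
    exact hd.congr_of_eventuallyEq ((line_mem hU hw (Pi.single i₁ 1)).mono fun t ht =>
      hrec _ ht (r - 1) (by omega))
  have hd2 : HasDerivAt (fun t : ℝ => θ 1 (w + t • Pi.single i₂ 1)) (-(q / 2)) 0 := by
    have hd : HasDerivAt (fun t : ℝ => -(q / 2) * wExt (w + t • Pi.single i₂ 1) ((r : ℤ) - 1))
        (-(q / 2)) 0 := by
      refine ((hasDerivAt_wExt_single i₂ w ((r : ℤ) - 1)).const_mul (-(q / 2))).congr_deriv ?_
      rw [if_pos (by simp only [i₂]; omega), mul_one]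
    refine hd.congr_of_eventuallyEq ((line_mem hU hw (Pi.single i₂ 1)).mono fun t ht => ?_)
    have := hrec _ ht 1 (by omega)
    simp only [Finset.sum_range_one, h0 _ ht, Nat.cast_one, Nat.cast_zero, add_zero] at this
    simp only [this]
    ring
  have hline : ∀ (j : ℕ) (i : Fin r), j < r →
      HasDerivAt (fun t : ℝ => θ j (w + t • Pi.single i 1)) (pd i (θ j) w) 0 := by
    intro j i hj
    have hdiff : DifferentiableAt ℝ (θ j) w := by
      rw [hθ j hj]
      exact differentiableAt_of_smooth hU (pd_contDiffOn hU hφ _) hw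
    simpa [Pi.single_apply] using hasDerivAt_line hdiff (Pi.single i 1)
  have p1 := hd1.unique (hline (r - 1) i₁ (by omega))
  have p2 := hd2.unique (hline 1 i₂ (by omega))
  rw [hθ (r - 1) (by omega)] at p1
  rw [hθ 1 (by omega)] at p2
  have hcomm : pd i₁ (pd ⟨r - 1, by omega⟩ φ) w = pd i₂ (pd ⟨1, by omega⟩ φ) w :=
    pd_comm hU hφ hw i₁ i₂
  rw [← p1, ← p2] at hcomm
  have h3 : q / 2 * ((r : ℝ) - 2) = 0 := by linarith
  have h4 : (r : ℝ) - 2 ≠ 0 := by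
    have : (2 : ℝ) < r := by exact_mod_cast hr
    linarith
  exact mul_ne_zero (div_ne_zero hq two_ne_zero) h4 h3

/-- Only `B_{0,1}` with `r ≤ 2` can come from a Frobenius manifold. -/
theorem IsGivenBy.classification [NeZero r] {a : Fin (r + 1) → ℝ} {k l : ℕ} (hk : k ≤ r)
    (hl : l ≤ r) (hkl : k ≠ l) {U : Set (Fin r → ℝ)} (hU : IsAdmissible k l U)
    {v : (Fin r → ℝ) → Fin r → ℝ} {F : (Fin r → ℝ) → ℝ} {η : Matrix (Fin r) (Fin r) ℝ}
    {q ρ : Fin r → ℝ} {d : ℝ} (h : IsGivenBy a k l U v F η q ρ d) :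
    (k = 0 ∧ l = 1) ∧ (r = 1 ∨ r = 2) := by
  have he : ∀ i, ContDiffOn ℝ ∞ (fun w => unitField k η v w i) U :=
    unitField_contDiffOn hU.isOpen h.coord
  have h1 : ∀ w ∈ U, lieMetric k (unitField k η v) w = 0 := fun w hw =>
    h.lieMetric_left hU.isOpen hw
  have h2 : ∀ w ∈ U, lieMetric l (unitField k η v) w = q 0 • metricP r k w := fun w hw =>
    h.lieMetric_right hU.isOpen hw
  have hq := scale_ne_zero hk hl hkl hU h1 h2 fun w hw => h.unitField_ne_zero hU.isOpen hw
  have hkl01 : k = 0 ∧ l = 1 := by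
    rcases lt_or_gt_of_ne hkl with hlt | hlt
    · exact eq_zero_one_of_lt hlt hl hU he h1 h2 hq
    · exact (not_lt_of_lie hlt hk hU he h1 h2 hq).elim
  refine ⟨hkl01, ?_⟩
  obtain ⟨rfl, rfl⟩ := hkl01
  have hr := le_two_of_closed hU.isOpen hU.nonempty hq (unitPotential_contDiffOn h.coord)
    fun w hw i => unitField_zero_one hU he h1 h2 hw i
  have : 1 ≤ r := NeZero.one_le
  omega

end Closed

/-! ### Rules for partial derivatives -/

section Rules

variable {r : ℕ} {f g : (Fin r → ℝ) → ℝ} {v : Fin r → ℝ}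

theorem pd_const (α : Fin r) (c : ℝ) : pd α (fun _ => c) v = 0 := by
  simp [pd]

theorem pd_coord (α β : Fin r) : pd α (fun u => u β) v = if β = α then 1 else 0 := by
  rw [pd, (hasFDerivAt_apply β v).fderiv]
  simp [Pi.single_apply]

theorem pd_add (α : Fin r) (hf : DifferentiableAt ℝ f v) (hg : DifferentiableAt ℝ g v) :
    pd α (fun u => f u + g u) v = pd α f v + pd α g v := by
  rw [pd, (hf.hasFDerivAt.fun_add hg.hasFDerivAt).fderiv]
  rfl

theorem pd_sub (α : Fin r) (hf : DifferentiableAt ℝ f v) (hg : DifferentiableAt ℝ g v) :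
    pd α (fun u => f u - g u) v = pd α f v - pd α g v := by
  rw [pd, (hf.hasFDerivAt.fun_sub hg.hasFDerivAt).fderiv]
  rfl

theorem pd_neg (α : Fin r) : pd α (fun u => -f u) v = -pd α f v := by
  simp [pd, fderiv_fun_neg]

theorem pd_mul (α : Fin r) (hf : DifferentiableAt ℝ f v) (hg : DifferentiableAt ℝ g v) :
    pd α (fun u => f u * g u) v = f v * pd α g v + g v * pd α f v := by
  rw [pd, (hf.hasFDerivAt.fun_mul hg.hasFDerivAt).fderiv]
  rfl

theorem pd_inv (α : Fin r) (hf : DifferentiableAt ℝ f v) (h0 : f v ≠ 0) :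
    pd α (fun u => (f u)⁻¹) v = -pd α f v / (f v) ^ 2 := by
  have h : HasFDerivAt (fun u => (f u)⁻¹) (-((f v) ^ 2)⁻¹ • fderiv ℝ f v) v :=
    (hasDerivAt_inv h0).comp_hasFDerivAt v hf.hasFDerivAt
  rw [pd, h.fderiv]
  simp only [smul_apply, smul_eq_mul, pd]
  field_simp

theorem pd_log (α : Fin r) (hf : DifferentiableAt ℝ f v) (h0 : f v ≠ 0) :
    pd α (fun u => Real.log (f u)) v = pd α f v / f v := by
  rw [pd, (hf.hasFDerivAt.log h0).fderiv]
  simp only [smul_apply, smul_eq_mul, pd]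
  field_simp

end Rules

/-- Christoffel symbols involve derivatives of the metric, so agreement is needed on an open set;
the closed form of the r = 2 intersection form holds only off v^2 = 0. -/
theorem hydroOp_congr {r : ℕ} {g g' : (Fin r → ℝ) → Matrix (Fin r) (Fin r) ℝ}
    {V : Set (Fin r → ℝ)} (hV : IsOpen V) (h : Set.EqOn g g' V) {v ξ : ℝ → Fin r → ℝ} {x : ℝ}
    (hx : v x ∈ V) (α : Fin r) : hydroOp g v ξ x α = hydroOp g' v ξ x α := by
  have hp : ∀ i j γ, pd γ (fun u => (g u)⁻¹ i j) (v x) = pd γ (fun u => (g' u)⁻¹ i j) (v x) :=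
    fun i j γ => pd_congr hV (fun u hu => by simp only [h hu]) hx γ
  simp only [hydroOp, christoffel, hp, h hx]

/-! ### The case `r = 1` -/

section One

variable {c : ℝ}

theorem pd3_cubic (m : ℝ) (v : Fin 1 → ℝ) (α β γ : Fin 1) :
    pd3 (fun v => m * (v 0 * (v 0 * v 0))) α β γ v = 6 * m := by
  have hα := Subsingleton.elim α 0
  have hβ := Subsingleton.elim β 0
  have hγ := Subsingleton.elim γ 0
  subst hα hβ hγ
  have h1 : pd (0 : Fin 1) (fun v => m * (v 0 * (v 0 * v 0))) = fun v => 3 * m * (v 0 * v 0) := by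
    funext u
    simp (disch := fun_prop) only [pd_mul, pd_const, pd_coord, if_true]
    ring
  have h2 : pd (0 : Fin 1) (fun v => 3 * m * (v 0 * v 0)) = fun v => 6 * m * v 0 := by
    funext u
    simp (disch := fun_prop) only [pd_mul, pd_const, pd_coord, if_true]
    ring
  rw [pd3, h1, h2]
  simp (disch := fun_prop) only [pd_mul, pd_const, pd_coord, if_true]
  ring

theorem inv_one_by_one (m : ℝ) : (!![m] : Matrix (Fin 1) (Fin 1) ℝ)⁻¹ = !![m⁻¹] := by
  ext i j
  fin_cases i
  fin_cases j
  simp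

theorem christoffel_one (v : Fin 1 → ℝ) (hv : v 0 ≠ 0) (hc : c ≠ 0) :
    christoffel (fun u : Fin 1 → ℝ => !![2 * c * u 0]) 0 0 0 v = -1 / (2 * v 0) := by
  have h0 : 2 * c * v 0 ≠ 0 := mul_ne_zero (mul_ne_zero two_ne_zero hc) hv
  have hp := pd_inv (f := fun u : Fin 1 → ℝ => 2 * c * u 0) (v := v) 0 (by fun_prop) h0
  simp (disch := fun_prop) only [pd_mul, pd_const, pd_coord, if_true] at hp
  simp only [christoffel, inv_one_by_one, Finset.univ_unique, Fin.default_eq_zero,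
    Finset.sum_singleton, Matrix.of_apply, Matrix.cons_val', Matrix.cons_val_fin_one, hp]
  field_simp
  ring

/-- In v^1 = c w^0 the metrics -2 and 2 w^0 become -2 c² and 2 c v^1. The first fixes η, hence the
cubic F, and the second fixes the Euler coefficient -1/c. -/
theorem isGivenBy_one (hc : c ≠ 0) (a : Fin (1 + 1) → ℝ) {U : Set (Fin 1 → ℝ)}
    (hU : IsAdmissible 0 1 U) :
    IsGivenBy a 0 1 U (fun w => ![c * w 0])
      (fun v => -1 / (12 * c ^ 2) * (v 0 * (v 0 * v 0))) !![-1 / (2 * c ^ 2)] ![-1 / c] ![0]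
      (3 + 3 / c) := by
  have hJ : ∀ w, jacobian (fun w : Fin 1 → ℝ => ![c * w 0]) w = !![c] := by
    intro w
    ext i j
    fin_cases i
    fin_cases j
    simp (disch := fun_prop) [jacobian, pd_mul, pd_const, pd_coord]
  have hopen : IsOpen ((fun w : Fin 1 → ℝ => ![c * w 0]) '' U) := by
    have : (fun w : Fin 1 → ℝ => ![c * w 0]) '' U = (fun u : Fin 1 → ℝ => ![u 0 / c]) ⁻¹' U := by
      ext u
      constructor
      · rintro ⟨w, hw, rfl⟩
        have e : ![c * w 0 / c] = w := by
          ext i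
          fin_cases i
          simp [mul_div_cancel_left₀ _ hc]
        rw [← e] at hw
        exact hw
      · intro hu
        refine ⟨_, hu, ?_⟩
        ext i
        fin_cases i
        simp [mul_div_cancel₀ _ hc]
    rw [this]
    refine hU.isOpen.preimage (continuous_pi fun i => ?_)
    fin_cases i
    simp
    fun_prop
  have hwne : ∀ w ∈ U, w 0 ≠ 0 := by
    intro w hw h0
    refine hU.det_right w hw ?_
    simp [metricP, coeffF, wExt, h0]
  have hη : (!![-1 / (2 * c ^ 2)] : Matrix (Fin 1) (Fin 1) ℝ)⁻¹ = !![-2 * c ^ 2] := by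
    rw [inv_one_by_one]
    congr 3
    field_simp
  have hg : ∀ u, intersectionForm (fun v : Fin 1 → ℝ => -1 / (12 * c ^ 2) * (v 0 * (v 0 * v 0)))
      !![-1 / (2 * c ^ 2)] ![-1 / c] ![0] u = !![2 * c * u 0] := by
    intro u
    ext i j
    fin_cases i
    fin_cases j
    simp [intersectionForm, pd3_cubic, hη]
    field_simp
    ring
  refine ⟨⟨?_, ?_, ?_⟩, ⟨hopen, ?_, ?_, ?_, ?_, ?_⟩, ?_, ?_⟩
  · refine ContDiff.contDiffOn (contDiff_pi.mpr fun i => ?_)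
    fin_cases i
    simp
    fun_prop
  · intro w _ w' _ h
    ext i
    fin_cases i
    have := congrFun h 0
    simpa [hc] using this
  · intro w _
    rw [hJ]
    simpa using hc
  · exact ContDiff.contDiffOn (by fun_prop)
  · intro v _ α β
    rw [pd3_cubic]
    fin_cases α
    fin_cases β
    simp
    field_simp
    norm_num
  · simp [hc]
  · intro v _ α β ν μ
    rw [Subsingleton.elim α 0, Subsingleton.elim μ 0]
  · refine ⟨0, 0, 0, fun v _ => ?_⟩
    simp (disch := fun_prop) [pd_mul, pd_const, pd_coord]
    field_simp
    ring
  · intro w ξ hw _ hU' hξ _ x α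
    fin_cases α
    simp [frobP, hη, hJ, leadingTerm, hamP, opD, coeffF, wExt]
    ring
  · intro w ξ hw _ hU' hξ _ x α
    have hch := christoffel_one ![c * w x 0] (by simpa using mul_ne_zero hc (hwne _ (hU' x))) hc
    have h0 := hwne _ (hU' x)
    fin_cases α
    simp only [frobQ, funext hg]
    simp [hydroOp, hJ, leadingTerm, hamP, opD, coeffF, wExt, hch]
    field_simp

end One

/-! ### The case `r = 2` -/

section Two

variable {c : ℝ}

/-- A potential on the complement of `v^2 = 0`. -/
noncomputable def potentialTwo (c : ℝ) (v : Fin 2 → ℝ) : ℝ :=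
  -1 / (4 * c) * (v 0 * (v 0 * v 1)) + c / 4 * (v 1 * (v 1 * Real.log (v 1)))

theorem isOpen_ne_zero : IsOpen {u : Fin 2 → ℝ | u 1 ≠ 0} :=
  isOpen_ne_fun (continuous_apply 1) continuous_const

/-- `Real.log` is log |·|, so one formula serves both signs of v^2. -/
theorem potentialTwo_smooth (c : ℝ) : ContDiffOn ℝ ∞ (potentialTwo c) {u | u 1 ≠ 0} := by
  unfold potentialTwo
  have h1 : ∀ i : Fin 2, ContDiffOn ℝ ∞ (fun u : Fin 2 → ℝ => u i) {u | u 1 ≠ 0} :=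
    fun i => (contDiff_apply ℝ ℝ i).contDiffOn
  exact (contDiffOn_const.mul ((h1 0).mul ((h1 0).mul (h1 1)))).add
    (contDiffOn_const.mul ((h1 1).mul ((h1 1).mul ((h1 1).log fun u hu => hu))))

theorem pd_log_coord {u : Fin 2 → ℝ} (hu : u 1 ≠ 0) (α : Fin 2) :
    pd α (fun u : Fin 2 → ℝ => Real.log (u 1)) u = (if 1 = α then 1 else 0) / u 1 := by
  rw [pd_log α (by fun_prop) hu, pd_coord]

theorem differentiableAt_log_coord {u : Fin 2 → ℝ} (hu : u 1 ≠ 0) :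
    DifferentiableAt ℝ (fun u : Fin 2 → ℝ => Real.log (u 1)) u :=
  DifferentiableAt.log (by fun_prop) hu

theorem pd_potentialTwo (hc : c ≠ 0) {u : Fin 2 → ℝ} (hu : u 1 ≠ 0) :
    pd 0 (potentialTwo c) u = -1 / (2 * c) * (u 0 * u 1) ∧
    pd 1 (potentialTwo c) u
      = -1 / (4 * c) * (u 0 * u 0) + c / 4 * (u 1 * (2 * Real.log (u 1) + 1)) := by
  have := differentiableAt_log_coord hu
  unfold potentialTwo
  constructor <;>
  · simp (disch := fun_prop (disch := assumption)) only [pd_add, pd_mul, pd_const, pd_coord,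
      pd_log_coord hu]
    simp [hc]
    field_simp
    ring

theorem pd_pd_potentialTwo (hc : c ≠ 0) {u : Fin 2 → ℝ} (hu : u 1 ≠ 0) :
    pd 0 (pd 0 (potentialTwo c)) u = -1 / (2 * c) * u 1 ∧
    pd 1 (pd 0 (potentialTwo c)) u = -1 / (2 * c) * u 0 ∧
    pd 0 (pd 1 (potentialTwo c)) u = -1 / (2 * c) * u 0 ∧
    pd 1 (pd 1 (potentialTwo c)) u = c / 4 * (2 * Real.log (u 1) + 3) := by
  have := differentiableAt_log_coord hu
  have e0 := fun α => pd_congr isOpen_ne_zero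
    (fun v (hv : v 1 ≠ 0) => (pd_potentialTwo hc hv).1) hu α
  have e1 := fun α => pd_congr isOpen_ne_zero
    (fun v (hv : v 1 ≠ 0) => (pd_potentialTwo hc hv).2) hu α
  rw [e0, e0, e1, e1]
  refine ⟨?_, ?_, ?_, ?_⟩ <;>
  · simp (disch := fun_prop (disch := assumption)) only [pd_add, pd_mul, pd_const, pd_coord,
      pd_log_coord hu]
    simp [hc]
    try field_simp
    try ring

/-- The third derivatives of the potential. -/
noncomputable def structureTwo (c : ℝ) (v : Fin 2 → ℝ) : Fin 2 → Matrix (Fin 2) (Fin 2) ℝ :=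
  ![!![0, -1 / (2 * c); -1 / (2 * c), 0], !![-1 / (2 * c), 0; 0, c / (2 * v 1)]]

theorem pd3_potentialTwo (hc : c ≠ 0) {u : Fin 2 → ℝ} (hu : u 1 ≠ 0) (α β γ : Fin 2) :
    pd3 (potentialTwo c) α β γ u = structureTwo c u α β γ := by
  have := differentiableAt_log_coord hu
  have e00 := fun α => pd_congr isOpen_ne_zero
    (fun v (hv : v 1 ≠ 0) => (pd_pd_potentialTwo hc hv).1) hu α
  have e10 := fun α => pd_congr isOpen_ne_zero
    (fun v (hv : v 1 ≠ 0) => (pd_pd_potentialTwo hc hv).2.1) hu α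
  have e01 := fun α => pd_congr isOpen_ne_zero
    (fun v (hv : v 1 ≠ 0) => (pd_pd_potentialTwo hc hv).2.2.1) hu α
  have e11 := fun α => pd_congr isOpen_ne_zero
    (fun v (hv : v 1 ≠ 0) => (pd_pd_potentialTwo hc hv).2.2.2) hu α
  fin_cases α <;> fin_cases β <;> fin_cases γ <;>
    simp only [Fin.zero_eta, Fin.mk_one, pd3, e00, e10, e01, e11] <;>
  · simp (disch := fun_prop (disch := assumption)) only [pd_add, pd_mul, pd_const, pd_coord,
      pd_log_coord hu]
    simp [structureTwo]
    try field_simp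
    try ring

/-- The intersection form in the flat coordinates. -/
noncomputable def formTwo (c : ℝ) (u : Fin 2 → ℝ) : Matrix (Fin 2) (Fin 2) ℝ :=
  !![-2 * c ^ 2, u 0; u 0, 2 * u 1]

/-- The flat metric of `potentialTwo`. -/
noncomputable def etaTwo (c : ℝ) : Matrix (Fin 2) (Fin 2) ℝ :=
  !![0, -1 / (2 * c); -1 / (2 * c), 0]

theorem etaTwo_inv (hc : c ≠ 0) : (etaTwo c)⁻¹ = !![0, -2 * c; -2 * c, 0] := by
  refine Matrix.inv_eq_right_inv ?_
  ext i j
  fin_cases i <;> fin_cases j <;> simp [etaTwo, Matrix.mul_apply] <;> field_simp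

theorem intersectionForm_two (hc : c ≠ 0) {u : Fin 2 → ℝ} (hu : u 1 ≠ 0) :
    intersectionForm (potentialTwo c) (etaTwo c) ![-1 / (2 * c), -1 / c] ![0, 0] u
      = formTwo c u := by
  ext i j
  simp only [intersectionForm, Matrix.of_apply, pd3_potentialTwo hc hu, etaTwo_inv hc,
    Fin.sum_univ_two, structureTwo, formTwo]
  fin_cases i <;> fin_cases j <;> simp <;> field_simp

theorem formTwo_inv (u : Fin 2 → ℝ) :
    (formTwo c u)⁻¹ = !![(-4 * c ^ 2 * u 1 - u 0 * u 0)⁻¹ * (2 * u 1),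
      (-4 * c ^ 2 * u 1 - u 0 * u 0)⁻¹ * -u 0; (-4 * c ^ 2 * u 1 - u 0 * u 0)⁻¹ * -u 0,
      (-4 * c ^ 2 * u 1 - u 0 * u 0)⁻¹ * (-2 * c ^ 2)] := by
  have h : -2 * c ^ 2 * (2 * u 1) - u 0 * u 0 = -4 * c ^ 2 * u 1 - u 0 * u 0 := by ring
  rw [formTwo, Matrix.inv_def, Matrix.det_fin_two_of, Matrix.adjugate_fin_two_of, h]
  simp

theorem pd_formTwo_inv {v : Fin 2 → ℝ} (hD : -4 * c ^ 2 * v 1 - v 0 * v 0 ≠ 0)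
    (α i j : Fin 2) :
    pd α (fun u => (formTwo c u)⁻¹ i j) v
      = -(![-2 * v 0, -4 * c ^ 2] : Fin 2 → ℝ) α / (-4 * c ^ 2 * v 1 - v 0 * v 0) ^ 2
          * (!![2 * v 1, -v 0; -v 0, -2 * c ^ 2] : Matrix (Fin 2) (Fin 2) ℝ) i j
        + (-4 * c ^ 2 * v 1 - v 0 * v 0)⁻¹
          * (![!![0, -1; -1, 0], !![2, 0; 0, 0]] : Fin 2 → Matrix (Fin 2) (Fin 2) ℝ) α i j := by
  have hi : ∀ α, pd α (fun u : Fin 2 → ℝ => (-4 * c ^ 2 * u 1 - u 0 * u 0)⁻¹) v = _ :=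
    fun α => pd_inv α (by fun_prop) hD
  have hd : DifferentiableAt ℝ (fun u : Fin 2 → ℝ => (-4 * c ^ 2 * u 1 - u 0 * u 0)⁻¹) v :=
    DifferentiableAt.inv (by fun_prop) hD
  simp only [formTwo_inv]
  fin_cases α <;> fin_cases i <;> fin_cases j <;>
    simp only [Fin.zero_eta, Fin.mk_one, Matrix.of_apply, Matrix.cons_val_zero,
      Matrix.cons_val_one, Matrix.cons_val', Matrix.cons_val_fin_one] <;>
    simp (disch := first | assumption | fun_prop) only [pd_sub, pd_neg, pd_mul, pd_const,
      pd_coord, hi] <;>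
    simp <;> ring

/-- The contravariant symbols are constant in these coordinates, which reduces the second operator
to a direct comparison. -/
theorem contravariant_christoffel_two {v : Fin 2 → ℝ}
    (hD : -4 * c ^ 2 * v 1 - v 0 * v 0 ≠ 0) (α β γ : Fin 2) :
    -∑ ν, formTwo c v α ν * christoffel (formTwo c) β ν γ v
      = if α = γ ∧ β = 1 then 1 else 0 := by
  simp only [christoffel, pd_formTwo_inv hD, Fin.sum_univ_two]
  -- The determinant is kept as an atom while denominators are cleared, and expanded only
  -- afterwards.
  obtain ⟨D, hDe⟩ : ∃ D, D = -4 * c ^ 2 * v 1 - v 0 * v 0 := ⟨_, rfl⟩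
  rw [← hDe] at hD ⊢
  fin_cases α <;> fin_cases β <;> fin_cases γ <;>
    simp [formTwo] <;> field_simp <;> rw [hDe] <;> ring

/-- The flat coordinates. -/
noncomputable def coordTwo (c : ℝ) (w : Fin 2 → ℝ) : Fin 2 → ℝ := ![c * w 1, w 0 - w 1 * w 1 / 4]

theorem jacobian_coordTwo (w : Fin 2 → ℝ) : jacobian (coordTwo c) w = !![0, c; 1, -w 1 / 2] := by
  ext i j
  simp only [jacobian, coordTwo, Matrix.of_apply, div_eq_mul_inv]
  fin_cases i <;> fin_cases j <;> simp only [Fin.zero_eta, Fin.mk_one,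
      Matrix.cons_val_zero, Matrix.cons_val_one, Matrix.cons_val', Matrix.cons_val_fin_one] <;>
    simp (disch := fun_prop) only [pd_sub, pd_mul, pd_const, pd_coord] <;> simp <;> ring

theorem image_coordTwo (hc : c ≠ 0) (U : Set (Fin 2 → ℝ)) :
    coordTwo c '' U = (fun u : Fin 2 → ℝ => ![u 1 + (u 0 / c) * (u 0 / c) / 4, u 0 / c]) ⁻¹' U := by
  refine congrFun (Set.image_eq_preimage_of_inverse ?_ ?_) U
  · intro w
    ext i
    fin_cases i <;> simp [coordTwo, mul_div_cancel_left₀ _ hc]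
  · intro u
    ext i
    fin_cases i <;> simp [coordTwo, mul_div_cancel₀ _ hc]

/-- If w^0 = (w^1)²/4 then -w^1/2 is a double root of W; thus v^2 ≠ 0 is exactly what distinctness
of the roots provides. -/
theorem discriminant_ne_zero {U : Set (Fin 2 → ℝ)} (hU : IsAdmissible 0 1 U) {w : Fin 2 → ℝ}
    (hw : w ∈ U) : w 0 - w 1 * w 1 / 4 ≠ 0 := by
  intro h
  have h0 : ((w 0 : ℝ) : ℂ) = (w 1 : ℂ) * w 1 / 4 := by
    rw [sub_eq_zero.mp h]
    push_cast
    rfl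
  have hz : (polyW w).eval (-(w 1 : ℂ) / 2) = 0 := by
    simp [polyW, h0]
    ring
  refine eval_derivative_polyW_ne_zero (hU.roots_distinct w hw) hz ?_
  simp [polyW]
  ring

theorem isGivenBy_two (hc : c ≠ 0) (a : Fin (2 + 1) → ℝ) {U : Set (Fin 2 → ℝ)}
    (hU : IsAdmissible 0 1 U) :
    IsGivenBy a 0 1 U (coordTwo c) (potentialTwo c) (etaTwo c) ![-1 / (2 * c), -1 / c] ![0, 0]
      (3 + 2 / c) := by
  have hV : ∀ v ∈ coordTwo c '' U, v 1 ≠ 0 := by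
    rintro _ ⟨w, hw, rfl⟩
    exact discriminant_ne_zero hU hw
  have hopen : IsOpen (coordTwo c '' U) := by
    rw [image_coordTwo hc]
    refine hU.isOpen.preimage (continuous_pi fun i => ?_)
    fin_cases i <;> simp <;> fun_prop
  have hwne : ∀ w ∈ U, w 0 ≠ 0 := by
    intro w hw h0
    refine hU.det_right w hw ?_
    simp [Matrix.det_fin_two, metricP, coeffF, wExt, h0]
  refine ⟨⟨?_, ?_, ?_⟩, ⟨hopen, (potentialTwo_smooth c).mono hV, ?_, ?_, ?_, ?_⟩, ?_, ?_⟩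
  · refine ContDiff.contDiffOn (contDiff_pi.mpr fun i => ?_)
    fin_cases i <;> simp [coordTwo] <;> fun_prop
  · intro w _ w' _ h
    have h0 := congrFun h 0
    have h1 := congrFun h 1
    simp [coordTwo, hc] at h0 h1
    rw [h0] at h1
    ext i
    fin_cases i
    · simpa using h1
    · exact h0
  · intro w _
    rw [jacobian_coordTwo]
    simpa [Matrix.det_fin_two] using hc
  · intro v hv α β
    rw [pd3_potentialTwo hc (hV v hv)]
    rfl
  · simp [etaTwo, Matrix.det_fin_two, hc]
  · intro v hv α β ν μ
    simp only [pd3_potentialTwo hc (hV v hv), etaTwo_inv hc, Fin.sum_univ_two]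
    have hv1 := hV v hv
    fin_cases α <;> fin_cases β <;> fin_cases ν <;> fin_cases μ <;>
      simp [structureTwo] <;> try ring
  -- The quadratic defect -(v^2)²/4 comes from the Euler field differentiating the logarithm.
  · refine ⟨!![0, 0; 0, -1 / 4], 0, 0, fun v hv => ?_⟩
    have hv1 := hV v hv
    obtain ⟨p0, p1⟩ := pd_potentialTwo hc hv1
    simp only [Fin.sum_univ_two, p0, p1, potentialTwo]
    simp
    field_simp
    ring
  · intro w ξ hw _ hUw hξ _ x α
    have hwd : ∀ i, DifferentiableAt ℝ (fun y => w y i) x := fun i =>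
      ((contDiff_pi.mp hw i).differentiable (by simp)).differentiableAt
    have hξd : ∀ i, DifferentiableAt ℝ (fun y => ξ y i) x := fun i =>
      ((contDiff_pi.mp hξ i).differentiable (by simp)).differentiableAt
    have d1 : deriv (fun y => c * ξ y 0 + -w y 1 / 2 * ξ y 1) x = c * deriv (fun y => ξ y 0) x
        + (-deriv (fun y => w y 1) x / 2 * ξ x 1 + -w x 1 / 2 * deriv (fun y => ξ y 1) x) :=
      (((hξd 0).hasDerivAt.const_mul c).fun_add
        (((hwd 1).hasDerivAt.fun_neg.div_const 2).fun_mul (hξd 1).hasDerivAt)).deriv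
    fin_cases α <;>
      simp [frobP, etaTwo_inv hc, jacobian_coordTwo, leadingTerm, hamP, opD, coeffF, wExt,
        Fin.sum_univ_two, d1] <;> ring
  · intro w ξ hw _ hUw hξ _ x α
    have hwd : ∀ i, DifferentiableAt ℝ (fun y => w y i) x := fun i =>
      ((contDiff_pi.mp hw i).differentiable (by simp)).differentiableAt
    have hξd : ∀ i, DifferentiableAt ℝ (fun y => ξ y i) x := fun i =>
      ((contDiff_pi.mp hξ i).differentiable (by simp)).differentiableAt
    have d1 : deriv (fun y => c * ξ y 0 + -w y 1 / 2 * ξ y 1) x = c * deriv (fun y => ξ y 0) x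
        + (-deriv (fun y => w y 1) x / 2 * ξ x 1 + -w x 1 / 2 * deriv (fun y => ξ y 1) x) :=
      (((hξd 0).hasDerivAt.const_mul c).fun_add
        (((hwd 1).hasDerivAt.fun_neg.div_const 2).fun_mul (hξd 1).hasDerivAt)).deriv
    have d2 : deriv (fun y => w y 0 - w y 1 * w y 1 / 4) x = deriv (fun y => w y 0) x
        - (deriv (fun y => w y 1) x * w x 1 + w x 1 * deriv (fun y => w y 1) x) / 4 :=
      ((hwd 0).hasDerivAt.fun_sub
        (((hwd 1).hasDerivAt.fun_mul (hwd 1).hasDerivAt).div_const 4)).deriv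
    -- The determinant of the intersection form is -4 c² w^0, nonzero because g_1 is nondegenerate.
    have hD : -4 * c ^ 2 * coordTwo c (w x) 1 - coordTwo c (w x) 0 * coordTwo c (w x) 0 ≠ 0 := by
      have : -4 * c ^ 2 * coordTwo c (w x) 1 - coordTwo c (w x) 0 * coordTwo c (w x) 0
          = -4 * c ^ 2 * w x 0 := by
        simp [coordTwo]
        ring
      rw [this]
      exact mul_ne_zero (mul_ne_zero (by norm_num) (pow_ne_zero 2 hc)) (hwne _ (hUw x))
    rw [frobQ, hydroOp_congr isOpen_ne_zero (fun u hu => intersectionForm_two hc hu)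
      (discriminant_ne_zero hU (hUw x)), hydroOp]
    simp only [contravariant_christoffel_two hD]
    fin_cases α <;>
      simp [formTwo, coordTwo, jacobian_coordTwo, leadingTerm, hamP, opD, coeffF, wExt,
        Fin.sum_univ_two, d1, d2] <;> ring

end Two

end RKdVCH

open RKdVCH
theorem mainTheorem6 :
    (∀ (r : ℕ) [NeZero r] (a : Fin (r + 1) → ℝ), a ≠ 0 →
      ∀ k l : ℕ, k ≤ r → l ≤ r → k ≠ l →
      ∀ U : Set (Fin r → ℝ), IsAdmissible k l U →
        ((∃ v F η q ρ d, IsGivenBy a k l U v F η q ρ d) ↔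
          (k = 0 ∧ l = 1) ∧ (r = 1 ∨ r = 2)) ∧
        ((∃ v F η q ρ d, q 0 = 1 ∧ IsGivenBy a k l U v F η q ρ d) ↔
          (k = 0 ∧ l = 1) ∧ (r = 1 ∨ r = 2))) ∧
    (∀ a : Fin (1 + 1) → ℝ, a ≠ 0 →
      ∀ U : Set (Fin 1 → ℝ), IsAdmissible 0 1 U →
        IsGivenBy a 0 1 U (fun w => ![w 0])
          (fun v => -(v 0) ^ 3 / 12)
          !![-1 / 2] ![-1] ![0] 6) ∧
    (∀ a : Fin (2 + 1) → ℝ, a ≠ 0 →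
      ∀ U : Set (Fin 2 → ℝ), IsAdmissible 0 1 U →
        IsGivenBy a 0 1 U (fun w => ![w 1, w 0 - (w 1) ^ 2 / 4])
          (fun v => -((v 0) ^ 2 * v 1) / 4 + (v 1) ^ 2 * Real.log (v 1) / 4)
          !![0, -1 / 2; -1 / 2, 0] ![-1 / 2, -1] ![0, 0] 5) := by
  refine ⟨fun r _ a _ k l hk hl hkl U hU => ?_, fun a _ U hU => ?_, fun a _ U hU => ?_⟩
  · have normalized : (k = 0 ∧ l = 1) ∧ (r = 1 ∨ r = 2) →
        ∃ v F η q ρ d, q 0 = 1 ∧ IsGivenBy a k l U v F η q ρ d := by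
      rintro ⟨⟨rfl, rfl⟩, rfl | rfl⟩
      -- The first Euler coefficient is -1/c for r = 1 and -1/(2c) for r = 2; these values of c make
      -- it 1.
      · exact ⟨_, _, _, _, _, _, by norm_num, isGivenBy_one (c := -1) (by norm_num) a hU⟩
      · exact ⟨_, _, _, _, _, _, by norm_num, isGivenBy_two (c := -1 / 2) (by norm_num) a hU⟩
    refine ⟨⟨?_, fun h => ?_⟩, ⟨?_, normalized⟩⟩
    · rintro ⟨v, F, η, q, ρ, d, h⟩
      exact h.classification hk hl hkl hU
    · obtain ⟨v, F, η, q, ρ, d, -, h⟩ := normalized h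
      exact ⟨v, F, η, q, ρ, d, h⟩
    · rintro ⟨v, F, η, q, ρ, d, -, h⟩
      exact h.classification hk hl hkl hU
  · convert isGivenBy_one (c := 1) one_ne_zero a hU using 1
    · simp
    · funext v
      ring
    · norm_num
    · norm_num
    · norm_num
  · convert isGivenBy_two (c := 1) one_ne_zero a hU using 1
    · funext w
      simp [coordTwo, sq]
    · funext v
      simp only [potentialTwo]
      ring
    · norm_num [etaTwo]
    · norm_num
    · norm_num
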